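/- Identify $\mathbb{Z}^2$ with the standard lattice in $\mathbb{R}^2$. A convex lattice polygon is a subset of $\mathbb{R}^2$ with non-empty interior that is the convex hull of finitely many points of $\mathbb{Z}^2$. It has type $t(P)=(i,b)$ if exactly $i$ points of $\mathbb{Z}^2$ lie in its interior and exactly $b$ points of $\mathbb{Z}^2$ lie on its boundary. Let $$T=\{(i,b)\in\mathbb{Z}_{\ge 0}^2 \mid (i=1 \text{ and } b\ge 7) \text{ or } (i\ge 2 \text{ and } b\ge 5)\},\qquad S=\{(i,b)\in T \mid i=1 \text{ or } i=2\}.$$ Let $P$ be a convex lattice polygon with $t(P)\in T$. Then there exists a convex lattice polygon $P'\subseteq P$ with $t(P')\in S$. -/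

import Mathlib

/-- The embedding of the lattice `ℤ²` into the plane `ℝ²`. -/
def latticePt (z : ℤ × ℤ) : ℝ × ℝ := ((z.1 : ℝ), (z.2 : ℝ))

/-- A convex lattice polygon: a two-dimensional (nonempty interior) subset of the plane that is
the convex hull of finitely many lattice points. -/
def IsConvexLatticePolygon (P : Set (ℝ × ℝ)) : Prop :=
  (interior P).Nonempty ∧ ∃ s : Finset (ℤ × ℤ), P = convexHull ℝ (latticePt '' (s : Set (ℤ × ℤ)))

/-- The lattice points in the (topological) interior of `P`. -/
def interiorLatticePoints (P : Set (ℝ × ℝ)) : Set (ℤ × ℤ) := {z | latticePt z ∈ interior P}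

/-- The lattice points on the (topological) boundary of `P`. -/
def boundaryLatticePoints (P : Set (ℝ × ℝ)) : Set (ℤ × ℤ) := {z | latticePt z ∈ frontier P}

/-- The type `(i, b)` of a polygon: the number `i` of lattice points in its interior and the
number `b` of lattice points on its boundary (both sets are finite for a lattice polygon,
which is compact). -/
noncomputable def polygonType (P : Set (ℝ × ℝ)) : ℕ × ℕ :=
  ((interiorLatticePoints P).ncard, (boundaryLatticePoints P).ncard)

/-- The set `T` of types `(i, b)` with `i = 1` and `b ≥ 7`, or `i ≥ 2` and `b ≥ 5`. -/
def typesT : Set (ℕ × ℕ) := {t | (t.1 = 1 ∧ 7 ≤ t.2) ∨ (2 ≤ t.1 ∧ 5 ≤ t.2)}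

/-- The set `S` of types `(i, b)` in `T` with `i = 1` or `i = 2`. -/
def typesS : Set (ℕ × ℕ) := {t | t ∈ typesT ∧ (t.1 = 1 ∨ t.1 = 2)}

/-! Encode a polygon by the finite set `L` of its lattice points and peel off vertices one at a
time. Removing a vertex that kills k interior points changes (i, b) into (i - k, b - 1 + k). If the
process halts inside T with i ≥ 3, then `L` is `Stuck`: each vertex kills nothing (and b = 5), or
kills everything, or kills exactly two points with (i, b) = (3, 5). It remains to show that no stuck
set exists (`not_stuck`).

A vertex that kills every interior point sees them all on the boundary of the hull of the remaining
points. Unless they are collinear, this boundary bends, and some lattice point behind the bend is an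
interior point that survives (`coll_of_killed_all`). Collinear interior points are impossible in a
stuck set: they confine `L` to three lattice rows and force b ≥ 6, so every vertex kills everything,
and then the two outer rows are too short (`Stuck.not_coll`). Hence no vertex kills everything, and
b = 5.

If i = 3, the interior points form a unimodular triangle, `L` lies in the triangle with vertices
(-1,-1), (3,-1), (-1,3), and counting boundary points corner by corner never gives five
(`Stuck.not_intrTriangle`). If i ≥ 4, no vertex kills anything, so the cone at each vertex is
unimodular (`exists_ear`). In coordinates adapted to one vertex, (0,0), (1,0), (0,1) and the next
boundary point on either side are all five boundary points, and each position of the last two is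
contradictory (`Stuck.not_quadrant`). -/

namespace LatticePolygon

/-! ### Finite lattice sets and integral functionals -/

/-- The value of the integral linear functional `g` at `s`. -/
def dot (g s : ℤ × ℤ) : ℤ := g.1 * s.1 + g.2 * s.2

/-- The determinant of two integral vectors. -/
def det (a b : ℤ × ℤ) : ℤ := a.1 * b.2 - a.2 * b.1

/-- `z` lies in the interior of the convex hull of `L`. -/
def IntPt (L : Finset (ℤ × ℤ)) (z : ℤ × ℤ) : Prop :=
  ∀ g : ℤ × ℤ, g ≠ 0 → ∃ s ∈ L, dot g z < dot g s

/-- `L` contains all lattice points of its convex hull. -/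
def LatConv (L : Finset (ℤ × ℤ)) : Prop :=
  ∀ z : ℤ × ℤ, (∀ g : ℤ × ℤ, ∃ s ∈ L, dot g z ≤ dot g s) → z ∈ L

/-- `v` is a vertex of the convex hull of `L`. -/
def Extreme (L : Finset (ℤ × ℤ)) (v : ℤ × ℤ) : Prop :=
  v ∈ L ∧ ∃ g : ℤ × ℤ, ∀ s ∈ L, s ≠ v → dot g s < dot g v

open Classical in
/-- The interior lattice points of `L`. -/
noncomputable def intr (L : Finset (ℤ × ℤ)) : Finset (ℤ × ℤ) := L.filter (IntPt L)

/-- The number of boundary points of `L`. -/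
noncomputable def bdry (L : Finset (ℤ × ℤ)) : ℕ := L.card - (intr L).card

/-- `z` does not lie in the interior of the hull of `L \ {v}`. -/
def Killed (L : Finset (ℤ × ℤ)) (v z : ℤ × ℤ) : Prop :=
  ∃ g : ℤ × ℤ, g ≠ 0 ∧ ∀ s ∈ L, s ≠ v → dot g s ≤ dot g z

/-- All points of `I` lie on a line. -/
def Coll (I : Finset (ℤ × ℤ)) : Prop :=
  ∀ p ∈ I, ∀ q ∈ I, ∀ r ∈ I, det (q - p) (r - p) = 0

variable {L : Finset (ℤ × ℤ)} {v z : ℤ × ℤ}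

theorem mem_intr : z ∈ intr L ↔ z ∈ L ∧ IntPt L z := by
  classical
  simp [intr]

theorem intr_subset (L : Finset (ℤ × ℤ)) : intr L ⊆ L := by
  intro z hz
  exact (mem_intr.1 hz).1

theorem mem_intr_of_intPt (hL : LatConv L) (h : IntPt L z) : z ∈ intr L := by
  refine mem_intr.2 ⟨hL z fun g => ?_, h⟩
  by_cases hg : g = 0
  · obtain ⟨s, hs, -⟩ := h (1, 0) (by simp)
    exact ⟨s, hs, by simp [hg, dot]⟩
  · obtain ⟨s, hs, h⟩ := h g hg
    exact ⟨s, hs, h.le⟩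

theorem bdry_add_card (L : Finset (ℤ × ℤ)) : bdry L + (intr L).card = L.card := by
  have := Finset.card_le_card (intr_subset L)
  unfold bdry
  omega

theorem not_intPt_erase : ¬ IntPt (L.erase v) z ↔ Killed L v z := by
  simp only [IntPt, Killed]
  push Not
  simp only [Finset.mem_erase]
  constructor
  · rintro ⟨g, hg, h⟩
    exact ⟨g, hg, fun s hs hv => h s ⟨hv, hs⟩⟩
  · rintro ⟨g, hg, h⟩
    exact ⟨g, hg, fun s hs => h s hs.2 hs.1⟩

theorem IntPt.mono {M : Finset (ℤ × ℤ)} (h : IntPt L z) (hM : L ⊆ M) : IntPt M z := by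
  intro g hg
  obtain ⟨s, hs, h⟩ := h g hg
  exact ⟨s, hM hs, h⟩

/-- The functional showing that `z` is killed by `v` separates `v` from the rest. -/
theorem dot_lt_of_killing {g : ℤ × ℤ} (hz : IntPt L z) (hg : g ≠ 0)
    (h : ∀ s ∈ L, s ≠ v → dot g s ≤ dot g z) : v ∈ L ∧ dot g z < dot g v := by
  obtain ⟨s, hs, hlt⟩ := hz g hg
  by_cases hv : s = v
  · exact hv ▸ ⟨hs, hlt⟩
  · exact absurd (h s hs hv) (not_le.2 hlt)

theorem extreme_of_killed (hz : IntPt L z) (h : Killed L v z) : Extreme L v := by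
  obtain ⟨g, hg, h⟩ := h
  obtain ⟨hv, hlt⟩ := dot_lt_of_killing hz hg h
  exact ⟨hv, g, fun s hs hsv => (h s hs hsv).trans_lt hlt⟩

theorem LatConv.erase (hL : LatConv L) (hv : Extreme L v) : LatConv (L.erase v) := by
  intro z hz
  rw [Finset.mem_erase]
  constructor
  · rintro rfl
    obtain ⟨-, g, hg⟩ := hv
    obtain ⟨s, hs, h⟩ := hz g
    rw [Finset.mem_erase] at hs
    exact absurd (hg s hs.2 hs.1) (not_lt.2 h)
  · refine hL z fun g => ?_
    obtain ⟨s, hs, h⟩ := hz g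
    exact ⟨s, Finset.mem_of_mem_erase hs, h⟩

theorem not_intPt_of_extreme (hv : Extreme L v) : ¬ IntPt L v := by
  intro h
  obtain ⟨hvL, g, hg⟩ := hv
  by_cases h0 : g = 0
  · subst h0
    obtain ⟨s, hs, hlt⟩ := h (1, 0) (by simp)
    have hsv : s ≠ v := by rintro rfl; exact lt_irrefl _ hlt
    simpa [dot] using hg s hs hsv
  · obtain ⟨s, hs, hlt⟩ := h g h0
    have hsv : s ≠ v := by rintro rfl; exact lt_irrefl _ hlt
    exact absurd (hg s hs hsv) (not_lt.2 hlt.le)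

/-! ### Barycentric combinations with integer weights -/

theorem dot_comb {g a b c z : ℤ × ℤ} {α β γ k : ℤ} (h1 : k * z.1 = α * a.1 + β * b.1 + γ * c.1)
    (h2 : k * z.2 = α * a.2 + β * b.2 + γ * c.2) :
    k * dot g z = α * dot g a + β * dot g b + γ * dot g c := by
  unfold dot
  linear_combination g.1 * h1 + g.2 * h2

theorem LatConv.mem_of_comb (hL : LatConv L) {a b c : ℤ × ℤ} {α β γ k : ℤ} (ha : a ∈ L)
    (hb : b ∈ L) (hc : c ∈ L) (hα : 0 ≤ α) (hβ : 0 ≤ β) (hγ : 0 ≤ γ) (hk : 0 < k)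
    (hsum : α + β + γ = k)
    (h1 : k * z.1 = α * a.1 + β * b.1 + γ * c.1) (h2 : k * z.2 = α * a.2 + β * b.2 + γ * c.2) :
    z ∈ L := by
  refine hL z fun g => ?_
  by_contra! h
  have e := dot_comb (g := g) h1 h2
  have ha := h a ha
  have hb := h b hb
  have hc := h c hc
  subst hsum
  rcases hα.lt_or_eq with h | h
  · nlinarith
  rcases hβ.lt_or_eq with h' | h'
  · nlinarith
  · have : 0 < γ := by omega
    nlinarith

/-- Positive weight on one interior vertex `a` suffices: a functional bounded on `L` by its value at
`z` is strictly smaller at `a`, so the weighted mean falls below that value. -/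
theorem intPt_of_comb {a b c : ℤ × ℤ} {α β γ k : ℤ} (ha : IntPt L a)
    (hb : b ∈ L) (hc : c ∈ L) (hα : 0 < α) (hβ : 0 ≤ β) (hγ : 0 ≤ γ)
    (hsum : α + β + γ = k)
    (h1 : k * z.1 = α * a.1 + β * b.1 + γ * c.1) (h2 : k * z.2 = α * a.2 + β * b.2 + γ * c.2) :
    IntPt L z := by
  intro g hg
  by_contra! h
  have e := dot_comb (g := g) h1 h2
  obtain ⟨s, hs, hlt⟩ := ha g hg
  have hs := h s hs
  have hb := h b hb
  have hc := h c hc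
  subst hsum
  nlinarith

/-- No three collinear points `v`, `a`, `z` in this order with `a ≠ v` in `L` if `v` kills `z`. -/
theorem not_killed_of_between {a : ℤ × ℤ} {α β : ℤ} (hz : IntPt L z) (ha : a ∈ L) (hav : a ≠ v)
    (hα : 0 < α) (hβ : 0 ≤ β) (h1 : (α + β) * a.1 = α * v.1 + β * z.1)
    (h2 : (α + β) * a.2 = α * v.2 + β * z.2) : ¬ Killed L v z := by
  rintro ⟨g, hg, h⟩
  obtain ⟨hv, hlt⟩ := dot_lt_of_killing hz hg h
  have e : (α + β) * dot g a = α * dot g v + β * dot g z := by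
    unfold dot; linear_combination g.1 * h1 + g.2 * h2
  have := h a ha hav
  nlinarith

/-! ### Lattice triangles and extreme points -/

theorem exists_coprime_factor {p : ℤ × ℤ} (hp : p ≠ 0) :
    ∃ (n : ℤ) (p₀ p' : ℤ × ℤ), 1 ≤ n ∧ p = n • p₀ ∧ det p₀ p' = 1 := by
  have hg : 0 < Int.gcd p.1 p.2 := by
    rw [Int.gcd_pos_iff]
    by_contra! h
    exact hp (Prod.ext h.1 h.2)
  obtain ⟨a, b, hab, h1, h2⟩ := Int.exists_gcd_one hg
  have hc : IsCoprime a b := Int.isCoprime_iff_gcd_eq_one.2 hab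
  obtain ⟨x, y, hxy⟩ := hc
  refine ⟨(Int.gcd p.1 p.2 : ℤ), (a, b), (-y, x), by exact_mod_cast hg, ?_, ?_⟩
  · ext
    · simpa [mul_comm] using h1
    · simpa [mul_comm] using h2
  · simp only [det]; linarith

/-- A lattice point at distance one from a primitive edge of a lattice triangle. -/
theorem exists_height_one {p p' s : ℤ × ℤ} {d : ℤ} (hp : det p p' = 1) (hd : det p s = d)
    (hd1 : 1 ≤ d) : ∃ (z : ℤ × ℤ) (m : ℤ), 0 ≤ m ∧ m + 1 ≤ d ∧ det p z = 1 ∧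
      d * z.1 = m * p.1 + s.1 ∧ d * z.2 = m * p.2 + s.2 := by
  set x := det s p' with hx
  -- `m` is the residue of `-x` modulo `d`; it is the shift along `p` that makes `m • p + s`
  -- divisible by `d`.
  have hdvd : (x + (-x) % d) = d * (-((-x) / d)) := by
    have := Int.emod_add_mul_ediv (-x) d
    linarith
  have h0 := Int.emod_nonneg (-x) (by omega : d ≠ 0)
  have h1 := Int.emod_lt_of_pos (-x) (by omega : 0 < d)
  set k := -((-x) / d)
  set m := (-x) % d
  refine ⟨(p'.1 + k * p.1, p'.2 + k * p.2), m, h0, by omega, ?_, ?_, ?_⟩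
  · unfold det at *; simp only; linear_combination hp
  · simp only [det] at *
    subst hd
    linear_combination (-p.1) * hdvd + p.1 * hx + s.1 * hp
  · simp only [det] at *
    subst hd
    linear_combination (-p.2) * hdvd + p.2 * hx + s.2 * hp

/-- A lattice triangle without further lattice points is unimodular. -/
theorem det_eq_one_of_empty {p q : ℤ × ℤ} {d : ℤ} (hd : det p q = d) (hd1 : 1 ≤ d)
    (h : ∀ (z : ℤ × ℤ) (m n : ℤ), 0 ≤ m → 0 ≤ n → m + n ≤ d → d * z.1 = m * p.1 + n * q.1 →
      d * z.2 = m * p.2 + n * q.2 → z = 0 ∨ z = p ∨ z = q) : d = 1 := by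
  have hp0 : p ≠ 0 := by rintro rfl; simp [det] at hd; omega
  obtain ⟨n, p₀, p', hn, rfl, hp'⟩ := exists_coprime_factor hp0
  have hdn : d = n * det p₀ q := by
    rw [← hd]; simp [det]; ring
  have hpos : 0 < det p₀ q := by nlinarith
  have hn1 : n = 1 := by
    -- The primitive vector `p₀` lies on the edge from 0 to `p`, so emptiness forces `p` itself to
    -- be primitive.
    rcases h p₀ (det p₀ q) 0 hpos.le le_rfl (by nlinarith)
      (by simp; rw [hdn]; ring) (by simp; rw [hdn]; ring) with h | h | h
    · subst h; simp [det] at hp'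
    · have h1 : det p₀ p' = n * det p₀ p' := by
        conv_lhs => rw [h]
        simp [det]; ring
      rw [hp'] at h1; omega
    · subst h
      have : det p₀ p₀ = 0 := by simp [det]; ring
      omega
  subst hn1
  rw [one_smul] at *
  obtain ⟨z, m, hm, hmd, hz, h1, h2⟩ := exists_height_one hp' hd hd1
  rcases h z m 1 hm zero_le_one hmd (by rw [h1]; ring) (by rw [h2]; ring) with e | e | e
  · subst e; simp [det] at hz
  · subst e; simp [det] at hz; linarith
  · subst e; omega

/-- Ties for the maximum of `g₀` are broken by the perpendicular functional `g₁`; a large multiple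
of `g₀` plus `g₁` then singles out the lexicographic maximum. -/
theorem exists_extreme_max (hL : L.Nonempty) {g₀ : ℤ × ℤ} (hg₀ : g₀ ≠ 0) :
    ∃ v, Extreme L v ∧ ∀ s ∈ L, dot g₀ s ≤ dot g₀ v := by
  set g₁ : ℤ × ℤ := (-g₀.2, g₀.1)
  obtain ⟨v, hv, hmax⟩ := L.exists_max_image (fun s => toLex (dot g₀ s, dot g₁ s)) hL
  have hmax' : ∀ s ∈ L, dot g₀ s < dot g₀ v ∨ dot g₀ s = dot g₀ v ∧ dot g₁ s ≤ dot g₁ v := by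
    intro s hs
    exact Prod.Lex.toLex_le_toLex.1 (hmax s hs)
  refine ⟨v, ⟨hv, ?_⟩, fun s hs => ?_⟩
  · set N : ℤ := 1 + ∑ s ∈ L, |dot g₁ s - dot g₁ v|
    have hN : ∀ s ∈ L, dot g₁ s - dot g₁ v < N := by
      intro s hs
      have := Finset.single_le_sum (f := fun s => |dot g₁ s - dot g₁ v|)
        (fun _ _ => abs_nonneg _) hs
      have h2 := le_abs_self (dot g₁ s - dot g₁ v)
      omega
    have hN0 : 0 < N := by simpa using hN v hv
    refine ⟨(N * g₀.1 + g₁.1, N * g₀.2 + g₁.2), fun s hs hsv => ?_⟩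
    have e : ∀ s, dot (N * g₀.1 + g₁.1, N * g₀.2 + g₁.2) s = N * dot g₀ s + dot g₁ s := by
      intro s; simp only [dot]; ring
    rw [e, e]
    have hNs := hN s hs
    rcases hmax' s hs with h | ⟨h, h'⟩
    · nlinarith
    · rcases h'.lt_or_eq with h' | h'
      · rw [h]; omega
      · exfalso
        apply hsv
        have hpos : 0 < g₀.1 ^ 2 + g₀.2 ^ 2 := by
          by_contra! hle
          apply hg₀
          ext
          · simp; nlinarith [sq_nonneg g₀.1, sq_nonneg g₀.2]
          · simp; nlinarith [sq_nonneg g₀.1, sq_nonneg g₀.2]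
        simp only [dot, g₁] at h h'
        ext
        · have : (g₀.1 ^ 2 + g₀.2 ^ 2) * (s.1 - v.1) = 0 := by
            linear_combination g₀.1 * h - g₀.2 * h'
          rcases mul_eq_zero.1 this with h | h <;> omega
        · have : (g₀.1 ^ 2 + g₀.2 ^ 2) * (s.2 - v.2) = 0 := by
            linear_combination g₀.2 * h + g₀.1 * h'
          rcases mul_eq_zero.1 this with h | h <;> omega
  · rcases hmax' s hs with h | h
    · exact h.le
    · exact h.1.le

/-! ### Stuck sets -/

/-- Every vertex removal leaves the class of admissible types. -/
structure Stuck (L : Finset (ℤ × ℤ)) : Prop where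
  conv : LatConv L
  three_le : 3 ≤ (intr L).card
  five_le : 5 ≤ bdry L
  not_mem : ∀ v ∈ L, LatConv (L.erase v) → ((intr (L.erase v)).card, bdry (L.erase v)) ∉ typesT

open Classical in
theorem intr_erase (hL : LatConv L) (hv : Extreme L v) :
    intr (L.erase v) = (intr L).filter (fun z => ¬ Killed L v z) := by
  ext z
  rw [Finset.mem_filter, mem_intr, ← not_intPt_erase, not_not]
  constructor
  · rintro ⟨-, h⟩
    exact ⟨mem_intr_of_intPt hL (h.mono (Finset.erase_subset _ _)), h⟩
  · rintro ⟨-, h⟩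
    exact mem_intr.1 (mem_intr_of_intPt (hL.erase hv) h)

open Classical in
/-- The interior points killed by `v`. -/
noncomputable def killedSet (L : Finset (ℤ × ℤ)) (v : ℤ × ℤ) : Finset (ℤ × ℤ) :=
  (intr L).filter (fun z => Killed L v z)

theorem mem_killedSet : z ∈ killedSet L v ↔ z ∈ intr L ∧ Killed L v z := by
  classical
  simp [killedSet]

/-- With k killed points the new type is (i - k, b - 1 + k). For i ≥ 3 and b ≥ 5 it leaves `typesT`
only if k = 0 and b = 5, or k = i, or k = i - 1 and b + i < 9; the last forces i = 3, b = 5. -/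
theorem Stuck.card_cases (h : Stuck L) (hv : Extreme L v) :
    ((killedSet L v).card = 0 ∧ bdry L = 5) ∨ (killedSet L v).card = (intr L).card ∨
      ((killedSet L v).card = 2 ∧ (intr L).card = 3 ∧ bdry L = 5) := by
  classical
  have h1 := h.not_mem v hv.1 (h.conv.erase hv)
  have h2 := Finset.card_filter_add_card_filter_not (s := intr L) (fun z => Killed L v z)
  have h3 := bdry_add_card (L.erase v)
  have h4 := bdry_add_card L
  rw [Finset.card_erase_of_mem hv.1] at h3
  rw [intr_erase h.conv hv] at h1 h3
  have h5 := h.three_le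
  have h6 := h.five_le
  simp only [typesT, Set.mem_ofPred_eq] at h1
  unfold killedSet
  generalize bdry (L.erase v) = b at *
  omega

/-- The possible numbers of killed points are 0, 2 and i ≥ 3, never 1. -/
theorem Stuck.exists_other (h : Stuck L) (hz : z ∈ intr L) (hk : Killed L v z) :
    ∃ z' ∈ intr L, z' ≠ z ∧ Killed L v z' := by
  classical
  have h1 := h.card_cases (extreme_of_killed (mem_intr.1 hz).2 hk)
  have h2 := h.three_le
  have hm : z ∈ killedSet L v := mem_killedSet.2 ⟨hz, hk⟩
  have h0 := Finset.card_pos.2 ⟨z, hm⟩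
  obtain ⟨z', hz', hne⟩ := Finset.exists_mem_ne (s := killedSet L v) (by omega) z
  rw [mem_killedSet] at hz'
  exact ⟨z', hz'.1, hne, hz'.2⟩

theorem killed_of_card (h : (killedSet L v).card = (intr L).card) (hz : z ∈ intr L) :
    Killed L v z := by
  have : killedSet L v = intr L :=
    Finset.eq_of_subset_of_card_le (fun z hz => (mem_killedSet.1 hz).1) h.ge
  rw [← this] at hz
  exact (mem_killedSet.1 hz).2

theorem Stuck.killed_of_six (h : Stuck L) (h6 : 6 ≤ bdry L) (hv : Extreme L v)
    (hz : z ∈ intr L) : Killed L v z := by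
  have := h.card_cases hv
  exact killed_of_card (by omega) hz

theorem Stuck.killed_of_four (h : Stuck L) (h4 : 4 ≤ (intr L).card) {z' : ℤ × ℤ}
    (hz' : z' ∈ intr L) (hk : Killed L v z') (hz : z ∈ intr L) : Killed L v z := by
  have := h.card_cases (extreme_of_killed (mem_intr.1 hz').2 hk)
  have h0 := Finset.card_pos.2 ⟨z', mem_killedSet.2 ⟨hz', hk⟩⟩
  exact killed_of_card (by omega) hz

/-! ### Change of coordinates -/

/-- A bijection of the lattice along which integral affine functionals can be transported. -/
def Unimod (φ : ℤ × ℤ ≃ ℤ × ℤ) : Prop :=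
  (∀ g, ∃ g' c, (g ≠ 0 → g' ≠ 0) ∧ ∀ s, dot g (φ s) = dot g' s + c) ∧
  (∀ g, ∃ g' c, (g ≠ 0 → g' ≠ 0) ∧ ∀ s, dot g (φ.symm s) = dot g' s + c)

theorem Unimod.symm {φ : ℤ × ℤ ≃ ℤ × ℤ} (h : Unimod φ) : Unimod φ.symm := ⟨h.2, h.1⟩

/-- The affine coordinates with origin `o` and basis `e`, `f`. -/
def frame (o e f : ℤ × ℤ) (h : det e f = 1) : ℤ × ℤ ≃ ℤ × ℤ where
  toFun s := (det (s - o) f, det e (s - o))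
  invFun s := o + s.1 • e + s.2 • f
  left_inv s := by
    simp only [det, Prod.fst_sub, Prod.snd_sub] at *
    ext
    · simp; linear_combination (s.1 - o.1) * h
    · simp; linear_combination (s.2 - o.2) * h
  right_inv s := by
    simp only [det, Prod.fst_sub, Prod.snd_sub] at *
    ext
    · simp; linear_combination s.1 * h
    · simp; linear_combination s.2 * h

theorem unimod_frame (o e f : ℤ × ℤ) (h : det e f = 1) : Unimod (frame o e f h) := by
  constructor
  · intro g
    refine ⟨(g.1 * f.2 - g.2 * e.2, g.2 * e.1 - g.1 * f.1),
      -(g.1 * det o f + g.2 * det e o), fun hg h0 => hg ?_, fun s => ?_⟩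
    · simp only [det, Prod.mk_eq_zero] at *
      ext
      · simp; linear_combination e.1 * h0.1 + e.2 * h0.2 - g.1 * h
      · simp; linear_combination f.1 * h0.1 + f.2 * h0.2 - g.2 * h
    · simp [frame, dot, det]; ring
  · intro g
    refine ⟨(dot g e, dot g f), dot g o, fun hg h0 => hg ?_, fun s => ?_⟩
    · simp only [dot, det, Prod.mk_eq_zero] at *
      ext
      · simp; linear_combination f.2 * h0.1 - e.2 * h0.2 - g.1 * h
      · simp; linear_combination e.1 * h0.2 - f.1 * h0.1 - g.2 * h
    · simp [frame, dot]; ring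

theorem unimod_swap : Unimod (Equiv.prodComm ℤ ℤ) := by
  have : ∀ g : ℤ × ℤ, ∃ g' c, (g ≠ 0 → g' ≠ 0) ∧ ∀ s : ℤ × ℤ, dot g s.swap = dot g' s + c :=
    fun g => ⟨g.swap, 0, fun hg h => hg (by simpa using congrArg Prod.swap h),
      fun s => by simp [dot]; ring⟩
  exact ⟨this, this⟩

section Transport

variable {φ : ℤ × ℤ ≃ ℤ × ℤ}

theorem IntPt.map (hφ : Unimod φ) (h : IntPt L z) : IntPt (L.map φ.toEmbedding) (φ z) := by
  intro g hg
  obtain ⟨g', c, hg', e⟩ := hφ.1 g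
  obtain ⟨s, hs, hlt⟩ := h g' (hg' hg)
  refine ⟨φ s, by simpa using hs, ?_⟩
  rw [e, e]; omega

theorem map_symm_map : (L.map φ.toEmbedding).map φ.symm.toEmbedding = L := by
  ext; simp

theorem intPt_map (hφ : Unimod φ) : IntPt (L.map φ.toEmbedding) (φ z) ↔ IntPt L z := by
  refine ⟨fun h => ?_, fun h => h.map hφ⟩
  have := h.map hφ.symm
  rwa [map_symm_map, φ.symm_apply_apply] at this

theorem LatConv.map (hφ : Unimod φ) (h : LatConv L) : LatConv (L.map φ.toEmbedding) := by
  intro z hz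
  obtain ⟨z, rfl⟩ := φ.surjective z
  suffices z ∈ L by simpa using this
  refine h z fun g => ?_
  obtain ⟨g', c, -, e⟩ := hφ.2 g
  obtain ⟨s, hs, hle⟩ := hz g'
  obtain ⟨s, hs', rfl⟩ := Finset.mem_map.1 hs
  refine ⟨s, hs', ?_⟩
  have h1 := e (φ z)
  have h2 := e (φ s)
  simp only [Equiv.symm_apply_apply, Equiv.coe_toEmbedding] at *
  omega

theorem latConv_map (hφ : Unimod φ) : LatConv (L.map φ.toEmbedding) ↔ LatConv L := by
  refine ⟨fun h => ?_, fun h => h.map hφ⟩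
  have := h.map hφ.symm
  rwa [map_symm_map] at this

theorem intr_map (hφ : Unimod φ) :
    intr (L.map φ.toEmbedding) = (intr L).map φ.toEmbedding := by
  ext z
  obtain ⟨z, rfl⟩ := φ.surjective z
  rw [mem_intr, intPt_map hφ, Finset.mem_map_equiv, Finset.mem_map_equiv, mem_intr,
    φ.symm_apply_apply]

theorem bdry_map (hφ : Unimod φ) : bdry (L.map φ.toEmbedding) = bdry L := by
  simp [bdry, intr_map hφ]

theorem Stuck.map (hφ : Unimod φ) (h : Stuck L) : Stuck (L.map φ.toEmbedding) where
  conv := h.conv.map hφ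
  three_le := by rw [intr_map hφ, Finset.card_map]; exact h.three_le
  five_le := by rw [bdry_map hφ]; exact h.five_le
  not_mem := by
    intro v hv hc
    obtain ⟨v, rfl⟩ := φ.surjective v
    have e : (L.map φ.toEmbedding).erase (φ v) = (L.erase v).map φ.toEmbedding := by
      ext z
      obtain ⟨z, rfl⟩ := φ.surjective z
      simp
    rw [e] at hc ⊢
    rw [intr_map hφ, bdry_map hφ, Finset.card_map]
    exact h.not_mem v (by simpa using hv) ((latConv_map hφ).1 hc)

theorem Killed.map (hφ : Unimod φ) (h : Killed L v z) :
    Killed (L.map φ.toEmbedding) (φ v) (φ z) := by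
  obtain ⟨g, hg, h⟩ := h
  obtain ⟨g', c, hg', e⟩ := hφ.2 g
  refine ⟨g', hg' hg, fun s hs hsv => ?_⟩
  obtain ⟨s, hs', rfl⟩ := Finset.mem_map.1 hs
  have h1 := e (φ z)
  have h2 := e (φ s)
  have h3 := h s hs' (by rintro rfl; exact hsv rfl)
  simp only [Equiv.symm_apply_apply, Equiv.coe_toEmbedding] at *
  omega

theorem killed_map (hφ : Unimod φ) :
    Killed (L.map φ.toEmbedding) (φ v) (φ z) ↔ Killed L v z := by
  refine ⟨fun h => ?_, fun h => h.map hφ⟩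
  have := h.map hφ.symm
  rwa [map_symm_map, φ.symm_apply_apply, φ.symm_apply_apply] at this

theorem Extreme.map (hφ : Unimod φ) (h : Extreme L v) :
    Extreme (L.map φ.toEmbedding) (φ v) := by
  obtain ⟨hv, g, h⟩ := h
  obtain ⟨g', c, -, e⟩ := hφ.2 g
  refine ⟨by simpa using hv, g', fun s hs hsv => ?_⟩
  obtain ⟨s, hs', rfl⟩ := Finset.mem_map.1 hs
  have h1 := e (φ v)
  have h2 := e (φ s)
  have h3 := h s hs' (by rintro rfl; exact hsv rfl)
  simp only [Equiv.symm_apply_apply, Equiv.coe_toEmbedding] at *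
  omega

end Transport

theorem exists_height_neg_one {p p' s : ℤ × ℤ} {d : ℤ} (hp : det p p' = 1) (hd : det p s = -d)
    (hd1 : 1 ≤ d) : ∃ (z : ℤ × ℤ) (m : ℤ), 0 ≤ m ∧ m + 1 ≤ d ∧ det p z = -1 ∧
      d * z.1 = m * p.1 + s.1 ∧ d * z.2 = m * p.2 + s.2 := by
  obtain ⟨z, m, h0, h1, h2, h3, h4⟩ := exists_height_one (p := p.swap) (p' := -p'.swap)
    (s := s.swap) (d := d) (by simp [det] at *; linarith) (by simp [det] at *; linarith) hd1
  refine ⟨z.swap, m, h0, h1, ?_, by simpa using h4, by simpa using h3⟩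
  simp [det] at *; linarith

theorem det_eq_zero_of_det_eq_zero {u a b : ℤ × ℤ} (hu : u ≠ 0) (ha : det u a = 0)
    (hb : det u b = 0) : det a b = 0 := by
  by_contra h
  apply hu
  unfold det at *
  ext
  · have : u.1 * (a.1 * b.2 - a.2 * b.1) = 0 := by linear_combination a.1 * hb - b.1 * ha
    simpa [h] using this
  · have : u.2 * (a.1 * b.2 - a.2 * b.1) = 0 := by linear_combination a.2 * hb - b.2 * ha
    simpa [h] using this

/-! ### A vertex that kills every interior point -/

theorem Killed.exists_pos (hz : IntPt L z) (h : Killed L 0 z) :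
    ∃ g : ℤ × ℤ, 0 < dot g z ∧ ∀ s ∈ L, s ≠ 0 → dot g z ≤ dot g s := by
  obtain ⟨g, hg, h⟩ := h
  have h1 := (dot_lt_of_killing hz hg h).2
  have e : ∀ s, dot (-g) s = - dot g s := fun s => by simp [dot]; ring
  refine ⟨-g, ?_, fun s hs h0 => ?_⟩
  · rw [e]; simp [dot] at *; omega
  · rw [e, e]; have := h s hs h0; omega

/-- The boundary of the hull of `L \ {0}` bends at (0,1) when `a ≠ 2`. Points of `L` beyond (1,0)
and beyond (-1,a) then enclose (0,2) as an interior point that survives the removal of 0, except in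
one configuration, which has at most seven lattice points. -/
theorem not_killed_all_of_corner (hL : LatConv L) (hcard : 8 ≤ L.card) (h0 : 0 ∈ L)
    (hk : ∀ z ∈ intr L, Killed L 0 z) (hp : (1, 0) ∈ intr L) (hq : (0, 1) ∈ intr L) {a : ℤ}
    (hr : (-1, a) ∈ intr L) (ha : a ≠ 2) : False := by
  obtain ⟨hpL, hpi⟩ := mem_intr.1 hp
  obtain ⟨hqL, hqi⟩ := mem_intr.1 hq
  obtain ⟨hrL, hri⟩ := mem_intr.1 hr
  obtain ⟨gp, hgp, hp'⟩ := (hk _ hp).exists_pos hpi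
  obtain ⟨gq, hgq, hq'⟩ := (hk _ hq).exists_pos hqi
  obtain ⟨gr, hgr, hr'⟩ := (hk _ hr).exists_pos hri
  have ha3 : 3 ≤ a := by
    have h1 := hq' _ hpL (by simp)
    have h2 := hq' _ hrL (by simp)
    simp [dot] at hgq h1 h2
    have : 2 ≤ a := by nlinarith
    omega
  -- Since (1,0) is interior, `L` continues past the ray through it; the functional that kills (1,0)
  -- forces `t ≥ 2`. The same is done past the ray through (-1,a) for `t'`.
  obtain ⟨t, ht, hzL⟩ : ∃ t : ℤ, 2 ≤ t ∧ (t, -1) ∈ L := by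
    obtain ⟨s, hs, hlt⟩ := hpi (0, -1) (by simp)
    simp [dot] at hlt
    obtain ⟨z, m, hm, hmd, hz, h1, h2⟩ := exists_height_neg_one (p := (1, 0)) (p' := (0, 1))
      (s := s) (d := -s.2) (by simp [det]) (by simp [det]) (by omega)
    have hzL : z ∈ L := hL.mem_of_comb (α := m) (β := 1) (γ := -s.2 - m - 1) (k := -s.2) hpL hs h0 hm
      zero_le_one (by omega) (by omega) (by ring) (by rw [h1]; simp) (by rw [h2]; simp)
    simp [det] at hz
    obtain ⟨t, y⟩ := z
    simp only at hz
    subst hz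
    refine ⟨t, ?_, hzL⟩
    have h3 := hp' _ hzL (by simp)
    have h4 := hp' _ hqL (by simp)
    simp [dot] at hgp h3 h4
    nlinarith
  obtain ⟨t', ht', hzL'⟩ : ∃ t : ℤ, 2 ≤ t ∧ (-t, t * a - 1) ∈ L := by
    obtain ⟨s, hs, hlt⟩ := hri (-a, -1) (by simp)
    simp [dot] at hlt
    obtain ⟨z, m, hm, hmd, hz, h1, h2⟩ := exists_height_one (p := (-1, a)) (p' := (0, -1))
      (s := s) (d := -s.2 - a * s.1) (by simp [det]) (by simp [det]) (by omega)
    have hzL : z ∈ L := hL.mem_of_comb (α := m) (β := 1) (γ := -s.2 - a * s.1 - m - 1)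
      (k := -s.2 - a * s.1) hrL hs h0 hm
      zero_le_one (by omega) (by omega) (by ring) (by rw [h1]; simp) (by rw [h2]; simp)
    obtain ⟨x, y⟩ := z
    simp [det] at hz
    obtain rfl : y = -x * a - 1 := by linarith
    have hx : 2 ≤ -x := by
      have h3 := hr' (x, -x * a - 1) hzL (by simp; rintro rfl; simp)
      have h4 := hr' _ hqL (by simp)
      simp [dot] at hgr h3 h4
      by_contra! hx
      nlinarith
    exact ⟨-x, hx, by simpa using hzL⟩
  have key : ¬ IntPt (L.erase 0) (0, 2) := fun h =>
    not_intPt_erase.2 (hk _ (mem_intr_of_intPt hL (h.mono (Finset.erase_subset _ _)))) h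
  rw [not_intPt_erase] at key
  obtain ⟨g, hg, h⟩ := key
  have h1 := h _ hqL (by simp)
  have h2 := h _ hzL (by simp)
  have h3 := h _ hzL' (by simp; omega)
  simp only [dot] at h1 h2 h3
  have hprod : 0 ≤ (t - 2) * (t' - 2) := mul_nonneg (by omega) (by omega)
  -- The sign tells whether (0,2) lies strictly below the segment from (t,-1) to (-t',t'a-1).
  by_cases hpos : 0 < t * t' * a - 3 * t - 3 * t'
  · have h4 : g.2 * (t * t' * a - 3 * t - 3 * t') ≤ 0 := by
      nlinarith [mul_le_mul_of_nonneg_left h2 (by omega : 0 ≤ t'),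
        mul_le_mul_of_nonneg_left h3 (by omega : 0 ≤ t)]
    have h5 : g.2 = 0 := by
      by_contra hne
      have : 0 < g.2 := by omega
      nlinarith
    rw [h5] at h2 h3
    have : g.1 = 0 := by
      apply le_antisymm
      · by_contra! h; nlinarith
      · by_contra! h; nlinarith
    exact hg (Prod.ext this h5)
  -- As t t' ≥ t + t' for t, t' ≥ 2, only a = 3 and t = t' = 2 remain; (0,2) is then the midpoint of
  -- (2,-1) and (-2,5).
  · have ha' : a = 3 := by
      by_contra hne
      have : 4 ≤ a := by omega
      nlinarith [mul_le_mul_of_nonneg_left this (by nlinarith : 0 ≤ t * t')]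
    subst ha'
    have ht2 : t = 2 := by nlinarith
    have ht2' : t' = 2 := by nlinarith
    subst ht2 ht2'
    norm_num at h2 h3 hzL'
    -- The list is 0 together with the lattice points of the triangle (0,1), (2,-1), (-2,5), to
    -- which `g`, `gp` and `gr` confine `L \ {0}`; an eighth point of `L` has no room.
    obtain ⟨x, hxL, hx⟩ : ∃ x ∈ L, x ∉ ({0, (1, 0), (0, 1), (-1, 3), (2, -1), (-2, 5), (0, 2)} :
        Finset (ℤ × ℤ)) := by
      refine Finset.exists_mem_notMem_of_card_lt_card (lt_of_le_of_lt (Finset.card_insert_le _ _) ?_)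
      have := Finset.card_le_six (a := ((1, 0) : ℤ × ℤ)) (b := (0, 1)) (c := (-1, 3)) (d := (2, -1))
        (e := (-2, 5)) (f := (0, 2))
      omega
    simp only [Finset.mem_insert, Finset.mem_singleton, not_or, Prod.ext_iff, Prod.fst_zero,
      Prod.snd_zero] at hx
    have hx0 : x ≠ 0 := by rintro rfl; simp at hx
    have h4 := h x hxL hx0
    have e1 : g.1 * 2 = g.2 * 3 := by omega
    have e2 : 0 < g.2 := by
      rcases (by omega : 0 ≤ g.2).lt_or_eq with h | h
      · exact h
      · exact absurd (Prod.ext (by simp; omega) h.symm) hg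
    simp only [dot] at h4
    have h5 : 3 * x.1 + 2 * x.2 ≤ 4 := by
      have e3 : g.2 * (3 * x.1 + 2 * x.2) ≤ g.2 * 4 := by
        have : g.1 * x.1 * 2 = g.2 * x.1 * 3 := by linear_combination x.1 * e1
        linarith
      exact le_of_mul_le_mul_left e3 e2
    have h6 : 1 ≤ x.1 + x.2 := by
      have i1 := hp' _ hzL (by simp)
      have i2 := hp' _ hqL (by simp)
      have i3 := hp' _ hxL hx0
      simp [dot] at hgp i1 i2 i3
      obtain i4 : gp.2 = gp.1 := by omega
      rw [i4] at i3
      by_contra! hlt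
      nlinarith
    have h7 : 1 ≤ 2 * x.1 + x.2 := by
      have i1 := hr' _ hzL' (by simp)
      have i2 := hr' _ hqL (by simp)
      have i3 := hr' _ hxL hx0
      simp [dot] at hgr i1 i2 i3
      obtain i4 : gr.1 = gr.2 * 2 := by omega
      rw [i4] at i3
      by_contra! hlt
      nlinarith
    omega

/-- Killed points lie on the part of the hull of `L \ {0}` facing 0, which each ray from 0 meets at
most once. -/
theorem eq_of_det_eq_zero (hk : ∀ z ∈ intr L, Killed L 0 z) {p q : ℤ × ℤ} (hp : p ∈ intr L)
    (hq : q ∈ intr L) (hp0 : p ≠ 0) (hq0 : q ≠ 0) (h : det p q = 0) : p = q := by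
  obtain ⟨hpL, hpi⟩ := mem_intr.1 hp
  obtain ⟨hqL, hqi⟩ := mem_intr.1 hq
  obtain ⟨gp, hgp, hp'⟩ := (hk _ hp).exists_pos hpi
  obtain ⟨gq, hgq, hq'⟩ := (hk _ hq).exists_pos hqi
  have h1 := hp' _ hqL hq0
  have h2 := hq' _ hpL hp0
  have e1 : dot gp q * p.1 = dot gp p * q.1 := by
    unfold dot det at *; linear_combination gp.2 * h
  have e2 : dot gp q * p.2 = dot gp p * q.2 := by
    unfold dot det at *; linear_combination -gp.1 * h
  have e3 : dot gp q * dot gq p = dot gp p * dot gq q := by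
    simp only [dot] at *; linear_combination gq.1 * e1 + gq.2 * e2
  have e4 : dot gp q = dot gp p := by nlinarith
  rw [e4] at e1 e2
  exact Prod.ext (mul_left_cancel₀ hgp.ne' e1) (mul_left_cancel₀ hgp.ne' e2)

/-- Every lattice point of the triangle 0, `p`, `q` other than 0 is interior to `L`. A further one
would lie on the ray of `p` or `q`, which carries only one interior point, or strictly between the
rays. -/
theorem det_eq_one_of_adjacent (hL : LatConv L) (h0 : 0 ∈ L) (h0' : 0 ∉ intr L)
    (hk : ∀ z ∈ intr L, Killed L 0 z)
    {p q : ℤ × ℤ} (hp : p ∈ intr L) (hq : q ∈ intr L) (hd : 0 < det p q)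
    (hadj : ∀ s ∈ intr L, 0 < det p s → ¬ 0 < det s q) : det p q = 1 := by
  obtain ⟨hpL, hpi⟩ := mem_intr.1 hp
  obtain ⟨hqL, hqi⟩ := mem_intr.1 hq
  refine det_eq_one_of_empty rfl hd fun z m n hm hn hmn h1 h2 => ?_
  by_contra! hne
  obtain ⟨hz0, hzp, hzq⟩ := hne
  have hzi : IntPt L z := by
    rcases hm.lt_or_eq with hm' | rfl
    · exact intPt_of_comb (α := m) (β := n) (γ := det p q - m - n) (k := det p q) hpi hqL h0 hm' hn
        (by omega) (by ring) (by rw [h1]; simp) (by rw [h2]; simp)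
    rcases hn.lt_or_eq with hn' | rfl
    · exact intPt_of_comb (α := n) (β := 0) (γ := det p q - n) (k := det p q) hqi hpL h0 hn' le_rfl
        (by omega) (by ring) (by rw [h1]; simp) (by rw [h2]; simp)
    · exfalso
      apply hz0
      ext
      · simpa [hd.ne'] using h1
      · simpa [hd.ne'] using h2
  have hz := mem_intr_of_intPt hL hzi
  have ne : ∀ {s}, s ∈ intr L → s ≠ 0 := fun hs h => h0' (h ▸ hs)
  have e1 : det p q * det p z = det p q * n := by
    simp only [det] at *; linear_combination p.1 * h2 - p.2 * h1
  have e2 : det p q * det z q = det p q * m := by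
    simp only [det] at *; linear_combination q.2 * h1 - q.1 * h2
  have e1 := mul_left_cancel₀ hd.ne' e1
  have e2 := mul_left_cancel₀ hd.ne' e2
  rcases hm.lt_or_eq with hm' | rfl
  · rcases hn.lt_or_eq with hn' | rfl
    · exact hadj z hz (by omega) (by omega)
    · exact hzp (eq_of_det_eq_zero hk hp hz (ne hp) (ne hz) e1).symm
  · exact hzq (eq_of_det_eq_zero hk hz hq (ne hz) (ne hq) e2)

theorem coll_map {φ : ℤ × ℤ ≃ ℤ × ℤ} {I : Finset (ℤ × ℤ)} {o e f : ℤ × ℤ} {h : det e f = 1}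
    (hφ : φ = frame o e f h) : Coll (I.map φ.toEmbedding) ↔ Coll I := by
  subst hφ
  have key : ∀ p q r, det (frame o e f h q - frame o e f h p) (frame o e f h r - frame o e f h p) =
      det (q - p) (r - p) := by
    intro p q r
    rw [← mul_one (det (q - p) _), ← h]
    simp [frame, det]; ring
  simp only [Coll, Finset.forall_mem_map, Equiv.coe_toEmbedding, key]

/-- Seen from 0, the interior points lie in an open half-plane and are ordered by angle. A
non-collinear triple shrinks to one whose neighbouring determinants are 1; there `p`, `q` is a basis
and `r = -p + a q`, with `a = 2` exactly in the collinear case. -/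
theorem coll_of_killed_zero (hL : LatConv L) (hcard : 8 ≤ L.card)
    (hk : ∀ z ∈ intr L, Killed L 0 z) : Coll (intr L) := by
  classical
  by_contra hc
  simp only [Coll] at hc
  push Not at hc
  obtain ⟨p, hp, q, hq, r, hr, hne⟩ := hc
  have h0 := extreme_of_killed (mem_intr.1 hp).2 (hk p hp)
  have h0' : 0 ∉ intr L := fun h => not_intPt_of_extreme h0 (mem_intr.1 h).2
  have ne : ∀ {s}, s ∈ intr L → s ≠ 0 := fun hs h => h0' (h ▸ hs)
  obtain ⟨g, hg⟩ : ∃ g : ℤ × ℤ, ∀ s ∈ intr L, 0 < dot g s := by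
    obtain ⟨g, hg, h⟩ := (hk p hp).exists_pos (mem_intr.1 hp).2
    exact ⟨g, fun s hs => hg.trans_le (h s (intr_subset _ hs) (ne hs))⟩
  have trans : ∀ a ∈ intr L, ∀ b ∈ intr L, ∀ c ∈ intr L, 0 < det a b → 0 < det b c →
      0 < det a c := by
    intro a ha b hb c hc h1 h2
    have e : dot g b * det a c = dot g a * det b c + dot g c * det a b := by
      unfold dot det; ring
    have := hg a ha
    have := hg b hb
    have := hg c hc
    by_contra! h
    nlinarith
  -- Induction on the number of interior points in the closed cone between `p` and `r`.
  have main : ∀ n : ℕ, ∀ p ∈ intr L, ∀ q ∈ intr L, ∀ r ∈ intr L, 0 < det p q → 0 < det q r →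
      det (q - p) (r - p) ≠ 0 → ((intr L).filter fun s => 0 ≤ det p s ∧ 0 ≤ det s r).card ≤ n →
      False := by
    intro n
    induction n with
    | zero =>
      intro p hp q hq r hr h1 h2 hne hn
      have : q ∈ (intr L).filter fun s => 0 ≤ det p s ∧ 0 ≤ det s r := by
        simp [hq, h1.le, h2.le]
      rw [Nat.le_zero, Finset.card_eq_zero] at hn
      simp [hn] at this
    | succ n ih =>
      intro p hp q hq r hr h1 h2 hne hn
      have h3 := trans p hp q hq r hr h1 h2
      have self : ∀ s, det s s = 0 := fun s => by unfold det; ring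
      have anti : ∀ s t, det s t = - det t s := fun s t => by unfold det; ring
      have shrinkl : ∀ s ∈ intr L, 0 < det p s → 
          ((intr L).filter fun t => 0 ≤ det s t ∧ 0 ≤ det t r).card ≤ n := by
        intro s hs hps
        refine Nat.lt_succ_iff.1 (lt_of_lt_of_le (Finset.card_lt_card ?_) hn)
        rw [Finset.ssubset_iff_of_subset]
        · refine ⟨p, by simp [hp, self, h3.le], ?_⟩
          simp [anti s p]
          intro _ h
          omega
        · intro t ht
          simp only [Finset.mem_filter] at ht ⊢
          refine ⟨ht.1, ?_, ht.2.2⟩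
          rcases ht.2.1.lt_or_eq with h | h
          · exact (trans p hp s hs t ht.1 hps h).le
          · rw [← eq_of_det_eq_zero hk hs ht.1 (ne hs) (ne ht.1) h.symm]
            exact hps.le
      have shrinkr : ∀ s ∈ intr L, 0 < det s r → 
          ((intr L).filter fun t => 0 ≤ det p t ∧ 0 ≤ det t s).card ≤ n := by
        intro s hs hsr
        refine Nat.lt_succ_iff.1 (lt_of_lt_of_le (Finset.card_lt_card ?_) hn)
        rw [Finset.ssubset_iff_of_subset]
        · refine ⟨r, by simp [hr, self, h3.le], ?_⟩
          simp [anti r s]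
          intro _ _
          omega
        · intro t ht
          simp only [Finset.mem_filter] at ht ⊢
          refine ⟨ht.1, ht.2.1, ?_⟩
          rcases ht.2.2.lt_or_eq with h | h
          · exact (trans t ht.1 s hs r hr h hsr).le
          · rw [eq_of_det_eq_zero hk ht.1 hs (ne ht.1) (ne hs) h.symm]
            exact hsr.le
      have hpq : det p q = 1 := by
        refine det_eq_one_of_adjacent hL h0.1 h0' hk hp hq h1 fun s hs hps hsq => ?_
        -- If `s`, `q`, `r` are collinear, then `p`, `s`, `q` are not, since otherwise `p`, `q`, `r`
        -- would be collinear too. Either way a smaller bad triple exists.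
        by_cases hc : det (q - s) (r - s) = 0
        · refine ih p hp s hs q hq hps hsq (fun hc' => hne ?_) (shrinkr q hq h2)
          have hqs : q - s ≠ 0 := by
            rw [sub_ne_zero]; rintro rfl; rw [self] at hsq; omega
          have hc2 : det (q - s) (p - s) = 0 := by
            simp only [det, Prod.fst_sub, Prod.snd_sub] at *; linear_combination hc'
          have h := det_eq_zero_of_det_eq_zero hqs hc hc2
          simp only [det, Prod.fst_sub, Prod.snd_sub] at *; linear_combination hc - hc2 + h
        · exact ih s hs q hq r hr hsq h2 hc (shrinkl s hs hps)
      have hqr : det q r = 1 := by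
        refine det_eq_one_of_adjacent hL h0.1 h0' hk hq hr h2 fun s hs hqs hsr => ?_
        by_cases hc : det (q - p) (s - p) = 0
        · refine ih q hq s hs r hr hqs hsr (fun hc' => hne ?_) (shrinkl q hq h1)
          have hqs : q - s ≠ 0 := by
            rw [sub_ne_zero]; rintro rfl; rw [self] at hqs; omega
          have hc2 : det (q - s) (p - s) = 0 := by
            simp only [det, Prod.fst_sub, Prod.snd_sub] at *; linear_combination -hc
          have hc3 : det (q - s) (r - s) = 0 := by
            simp only [det, Prod.fst_sub, Prod.snd_sub] at *; linear_combination -hc'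
          have h := det_eq_zero_of_det_eq_zero hqs hc3 hc2
          simp only [det, Prod.fst_sub, Prod.snd_sub] at *; linear_combination hc3 - hc2 + h
        · exact ih p hp q hq s hs h1 hqs hc (shrinkr s hs hsr)
      have hφ := unimod_frame 0 p q hpq
      have e0 : frame 0 p q hpq 0 = 0 := by simp [frame, det]
      have ep : frame 0 p q hpq p = (1, 0) := by
        ext
        · simp [frame, hpq]
        · simp [frame, self]
      have eq : frame 0 p q hpq q = (0, 1) := by
        ext
        · simp [frame, self]
        · simp [frame, hpq]
      have er : frame 0 p q hpq r = (-1, det p r) := by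
        ext
        · simp [frame, anti r q, hqr]
        · simp [frame]
      have mem : ∀ s ∈ intr L, frame 0 p q hpq s ∈ intr (L.map (frame 0 p q hpq).toEmbedding) := by
        intro s hs
        rw [intr_map hφ]
        simpa using hs
      refine not_killed_all_of_corner (hL.map hφ) (by simpa using hcard)
        ((Finset.mem_map' _).2 h0.1 |> fun h => by rwa [Equiv.coe_toEmbedding, e0] at h) ?_ (ep ▸ mem p hp) (eq ▸ mem q hq) (er ▸ mem r hr) ?_
      · intro z hz
        rw [intr_map hφ] at hz
        obtain ⟨z, hz', rfl⟩ := Finset.mem_map.1 hz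
        have := (hk z hz').map hφ
        rwa [e0] at this
      · intro h
        apply hne
        have e : det (q - p) (r - p) = det p q + det q r - det p r := by simp [det]; ring
        rw [e, hpq, hqr, h]; norm_num
  have perm : ∀ p ∈ intr L, ∀ q ∈ intr L, ∀ r ∈ intr L, 0 < det p q → 0 < det q r →
      det (q - p) (r - p) ≠ 0 → False := fun p hp q hq r hr h1 h2 h3 =>
    main _ p hp q hq r hr h1 h2 h3 le_rfl
  have anti : ∀ s t, det s t = - det t s := fun s t => by unfold det; ring
  have lt_or : ∀ a ∈ intr L, ∀ b ∈ intr L, a ≠ b → 0 < det a b ∨ 0 < det b a := by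
    intro a ha b hb hab
    by_contra! h
    refine hab (eq_of_det_eq_zero hk ha hb (ne ha) (ne hb) ?_)
    have := anti a b
    omega
  have self : ∀ s, det s 0 = 0 ∧ det 0 s = 0 ∧ det s s = 0 := fun s => by
    simp [det]; ring
  have hpq : p ≠ q := by rintro rfl; simp [self] at hne
  have hpr : p ≠ r := by rintro rfl; simp [self] at hne
  have hqr : q ≠ r := by rintro rfl; simp [self] at hne
  have sym : ∀ a b c : ℤ × ℤ, det (b - a) (c - a) = det b c + det a b - det a c := by
    intro a b c; simp [det]; ring
  rw [sym] at hne
  have a1 := anti p q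
  have a2 := anti q r
  have a3 := anti p r
  rcases lt_or p hp q hq hpq with h1 | h1 <;> rcases lt_or q hq r hr hqr with h2 | h2 <;>
    rcases lt_or p hp r hr hpr with h3 | h3
  · exact perm p hp q hq r hr h1 h2 (by rw [sym]; omega)
  · exact perm p hp q hq r hr h1 h2 (by rw [sym]; omega)
  · exact perm p hp r hr q hq h3 h2 (by rw [sym]; omega)
  · exact perm r hr p hp q hq h3 h1 (by rw [sym]; omega)
  · exact perm q hq p hp r hr h1 h3 (by rw [sym]; omega)
  · exact perm q hq r hr p hp h2 h3 (by rw [sym]; omega)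
  · exact perm r hr q hq p hp h2 h1 (by rw [sym]; omega)
  · exact perm r hr q hq p hp h2 h1 (by rw [sym]; omega)

/-- If a vertex kills every interior point, then the interior points are collinear. -/
theorem coll_of_killed_all (hL : LatConv L) (hcard : 8 ≤ L.card)
    (hk : ∀ z ∈ intr L, Killed L v z) : Coll (intr L) := by
  have h1 : det (1, 0) (0, 1) = 1 := by simp [det]
  have hφ := unimod_frame v (1, 0) (0, 1) h1
  have e : frame v (1, 0) (0, 1) h1 v = 0 := by simp [frame, det]
  rw [← coll_map (rfl : frame v (1, 0) (0, 1) h1 = _), ← intr_map hφ]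
  refine coll_of_killed_zero (hL.map hφ) (by simpa using hcard) fun z hz => ?_
  rw [intr_map hφ] at hz
  obtain ⟨z, hz', rfl⟩ := Finset.mem_map.1 hz
  have := (hk z hz').map hφ
  rwa [e] at this

/-! ### Collinear interior points -/

theorem mem_map_frame {o e f : ℤ × ℤ} {h : det e f = 1} {x y : ℤ} :
    (x, y) ∈ L.map (frame o e f h).toEmbedding ↔ o + x • e + y • f ∈ L := by
  rw [Finset.mem_map_equiv]; rfl

/-- The interior points of `L` are `(0,0), …, (n,0)`. -/
def IntrSegment (L : Finset (ℤ × ℤ)) (n : ℤ) : Prop :=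
  ∀ z, z ∈ intr L ↔ z.2 = 0 ∧ 0 ≤ z.1 ∧ z.1 ≤ n

theorem det_rot : det (-1, 0) (0, -1) = 1 := by simp [det]

theorem mem_rot {n x y : ℤ} :
    (x, y) ∈ L.map (frame (n, 0) (-1, 0) (0, -1) det_rot).toEmbedding ↔ (n - x, -y) ∈ L := by
  rw [mem_map_frame]
  simp [sub_eq_add_neg]

theorem IntrSegment.rot {n : ℤ} (h : IntrSegment L n) :
    IntrSegment (L.map (frame (n, 0) (-1, 0) (0, -1) det_rot).toEmbedding) n := by
  rintro ⟨x, y⟩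
  rw [intr_map (unimod_frame _ _ _ _), mem_rot, h]
  constructor <;> (intro h; simp only at *; omega)

/-- A point at height at least 2 spans with the edge (0,0), (1,0) a triangle containing a lattice
point at height 1, which would be interior. -/
theorem IntrSegment.snd_le_one {n : ℤ} (hL : LatConv L) (h : IntrSegment L n) (hn : 2 ≤ n)
    {s : ℤ × ℤ} (hs : s ∈ L) : s.2 ≤ 1 := by
  by_contra! hlt
  obtain ⟨z, m, hm, hmd, hz, h1, h2⟩ := exists_height_one (p := (1, 0)) (p' := (0, 1)) (s := s)
    (d := s.2) (by simp [det]) (by simp [det]) (by omega)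
  obtain ⟨h0L, h0i⟩ := mem_intr.1 ((h (0, 0)).2 ⟨rfl, le_rfl, by simp only; omega⟩)
  obtain ⟨h1L, h1i⟩ := mem_intr.1 ((h (1, 0)).2 ⟨rfl, by simp, by simp only; omega⟩)
  have hzi : IntPt L z := by
    by_cases hc : m = 0
    · exact intPt_of_comb (α := s.2 - 1 - m) (β := m) (γ := 1) (k := s.2) h0i h1L hs (by omega) hm
        zero_le_one (by ring) (by rw [h1]; simp) (by rw [h2]; simp)
    · exact intPt_of_comb (α := m) (β := s.2 - 1 - m) (γ := 1) (k := s.2) h1i h0L hs (by omega)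
        (by omega) zero_le_one (by ring) (by rw [h1]; simp) (by rw [h2]; simp)
  have h3 := ((h z).1 (mem_intr_of_intPt hL hzi)).1
  simp [det] at hz
  omega

theorem IntrSegment.neg_one_le_snd {n : ℤ} (hL : LatConv L) (h : IntrSegment L n) (hn : 2 ≤ n)
    {s : ℤ × ℤ} (hs : s ∈ L) : -1 ≤ s.2 := by
  have := h.rot.snd_le_one (hL.map (unimod_frame _ _ _ _)) hn (s := (n - s.1, -s.2))
    (by rw [mem_rot]; simpa using hs)
  simp only at this
  omega

/-- If the leftmost points of rows 1 and -1 had a + b ≥ 0, only (-1,0) could lie to the left of the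
line through (0,0) and (a,1). It would then kill (0,0) and nothing else, which is impossible in a
stuck set. -/
theorem Stuck.exists_left {n : ℤ} (hS : Stuck L) (h : IntrSegment L n) (hn : 2 ≤ n) :
    ∃ a b : ℤ, (a, 1) ∈ L ∧ (b, -1) ∈ L ∧ a + b < 0 := by
  classical
  have hL := hS.conv
  have hu := fun s hs => h.snd_le_one hL hn (s := s) hs
  have hl := fun s hs => h.neg_one_le_snd hL hn (s := s) hs
  have h0 : ((0, 0) : ℤ × ℤ) ∈ intr L := (h (0, 0)).2 ⟨rfl, le_rfl, by simp only; omega⟩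
  obtain ⟨h0L, h0i⟩ := mem_intr.1 h0
  have row : ∀ ε : ℤ, ε = 1 ∨ ε = -1 → ∃ a, (a, ε) ∈ L ∧ ∀ x, (x, ε) ∈ L → a ≤ x := by
    intro ε hε
    obtain ⟨s, hs, hlt⟩ := h0i (0, ε) (by simp; omega)
    have h1 := hu s hs
    have h2 := hl s hs
    have hsε : s.2 = ε := by
      rcases hε with rfl | rfl <;> simp [dot] at hlt <;> omega
    obtain ⟨a, ha, hmin⟩ := (L.filter fun s => s.2 = ε).exists_min_image Prod.fst
      ⟨s, by simp [hs, hsε]⟩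
    rw [Finset.mem_filter] at ha
    exact ⟨a.1, by rw [← ha.2]; exact ha.1, fun x hx => hmin (x, ε) (by simp [hx])⟩
  obtain ⟨a, ha, hamin⟩ := row 1 (Or.inl rfl)
  obtain ⟨b, hb, hbmin⟩ := row (-1) (Or.inr rfl)
  refine ⟨a, b, ha, hb, ?_⟩
  by_contra! hab
  have key : ∀ s ∈ L, (s.2 = 0 → 0 ≤ s.1) → dot (-1, a) s ≤ 0 := by
    rintro ⟨x, y⟩ hs hx
    have h1 := hu _ hs
    have h2 := hl _ hs
    simp only [dot] at *
    rcases (by omega : y = 1 ∨ y = 0 ∨ y = -1) with rfl | rfl | rfl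
    · have := hamin x hs; omega
    · have := hx rfl; omega
    · have := hbmin x hs; omega
  have g0 : ((-1, a) : ℤ × ℤ) ≠ 0 := by simp
  by_cases hc : ((-1, 0) : ℤ × ℤ) ∈ L
  · have hkill : Killed L (-1, 0) (0, 0) := by
      refine ⟨(-1, a), g0, fun s hs hsv => (key s hs fun hs2 => ?_).trans (by simp [dot])⟩
      by_contra! hs1
      have hs3 : s.1 ≠ -1 := fun h => hsv (Prod.ext h hs2)
      have : IntPt L (-1, 0) := intPt_of_comb (α := -s.1 - 1) (β := 1) (γ := 0) (k := -s.1) h0i hs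
        hs (by omega) zero_le_one le_rfl (by ring) (by simp) (by simp [hs2])
      have := ((h _).1 (mem_intr_of_intPt hL this)).2.1
      simp at this
    obtain ⟨z, hz, hne, hzk⟩ := hS.exists_other h0 hkill
    obtain ⟨hz2, hz1, -⟩ := (h z).1 hz
    have hz3 : z.1 ≠ 0 := fun h => hne (Prod.ext h hz2)
    exact not_killed_of_between (α := z.1) (β := 1) (mem_intr.1 hz).2 h0L (by simp) (by omega)
      zero_le_one (by simp) (by simp [hz2]) hzk
  · obtain ⟨s, hs, hlt⟩ := h0i _ g0
    have := key s hs fun hs2 => by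
      by_contra! hs1
      exact hc (hL.mem_of_comb (α := 1) (β := -s.1 - 1) (γ := 0) (k := -s.1) hs h0L h0L zero_le_one
        (by omega) le_rfl (by omega) (by ring) (by simp) (by simp [hs2]))
    simp [dot] at hlt this
    omega

theorem card_offline_le {n a₁ a₂ b₁ b₂ : ℤ} (hL : LatConv L) (h : IntrSegment L n)
    (ha₁ : (a₁, 1) ∈ L) (ha₂ : (a₂, 1) ∈ L) (hb₁ : (b₁, -1) ∈ L) (hb₂ : (b₂, -1) ∈ L) :
    a₂ - a₁ + (b₂ - b₁) + 2 ≤ bdry L := by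
  classical
  have fill : ∀ ε x₁ x₂ x : ℤ, (x₁, ε) ∈ L → (x₂, ε) ∈ L → x₁ ≤ x → x ≤ x₂ → (x, ε) ∈ L := by
    intro ε x₁ x₂ x h1 h2 hx1 hx2
    rcases hx1.lt_or_eq with h | rfl
    · exact hL.mem_of_comb (α := x₂ - x) (β := x - x₁) (γ := 0) (k := x₂ - x₁) h1 h2 h2 (by omega)
        (by omega) le_rfl (by omega) (by ring) (by ring) (by ring)
    · exact h1
  have hsub : (Finset.Icc a₁ a₂).map ⟨fun x => (x, 1), fun x y h => congrArg Prod.fst h⟩ ∪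
      (Finset.Icc b₁ b₂).map ⟨fun x => (x, -1), fun x y h => congrArg Prod.fst h⟩ ⊆
      L \ intr L := by
    intro z hz
    rw [Finset.mem_union, Finset.mem_map, Finset.mem_map] at hz
    rw [Finset.mem_sdiff, h]
    rcases hz with ⟨x, hx, rfl⟩ | ⟨x, hx, rfl⟩ <;> rw [Finset.mem_Icc] at hx
    · exact ⟨fill 1 a₁ a₂ x ha₁ ha₂ hx.1 hx.2, fun h => absurd h.1 (one_ne_zero (α := ℤ))⟩
    · exact ⟨fill (-1) b₁ b₂ x hb₁ hb₂ hx.1 hx.2,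
        fun h => absurd h.1 (neg_ne_zero.2 (one_ne_zero (α := ℤ)))⟩
  have h1 := Finset.card_le_card hsub
  rw [Finset.card_sdiff_of_subset (intr_subset L), Finset.card_union_of_disjoint, Finset.card_map,
    Finset.card_map, Int.card_Icc, Int.card_Icc] at h1
  · unfold bdry
    omega
  · rw [Finset.disjoint_left]
    intro z hz hz'
    rw [Finset.mem_map] at hz hz'
    obtain ⟨x, -, rfl⟩ := hz
    obtain ⟨y, -, h⟩ := hz'
    have : (-1 : ℤ) = 1 := congrArg Prod.snd h
    omega

/-- The left bound and its rotated form make rows ±1 long enough for b ≥ 6, so every vertex kills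
all interior points. A highest or lowest vertex can kill (1,0), between (0,0) and (2,0), only
through a horizontal line, so it is alone in its row; two one-point rows contradict the length. -/
theorem Stuck.not_intrSegment {n : ℤ} (hS : Stuck L) (hn : 2 ≤ n) : ¬ IntrSegment L n := by
  intro h
  have hL := hS.conv
  obtain ⟨a₁, b₁, ha₁, hb₁, h1⟩ := hS.exists_left h hn
  obtain ⟨b', a', hb₂, ha₂, h2⟩ := (hS.map (unimod_frame _ _ _ _)).exists_left h.rot hn
  rw [mem_rot] at ha₂ hb₂
  rw [neg_neg] at ha₂
  have hb := card_offline_le hL h ha₁ ha₂ hb₁ hb₂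
  have h0 : ((0, 0) : ℤ × ℤ) ∈ L := intr_subset _ ((h _).2 ⟨rfl, le_rfl, by simp only; omega⟩)
  have hI : ((1, 0) : ℤ × ℤ) ∈ intr L := (h _).2 ⟨rfl, zero_le_one, by simp only; omega⟩
  have hI2 : ((2, 0) : ℤ × ℤ) ∈ L := intr_subset _ ((h _).2 ⟨rfl, zero_le_two, by simp only; omega⟩)
  have top : ∀ ε : ℤ, ε = 1 ∨ ε = -1 → (∃ x, (x, ε) ∈ L) → (∃ x, (x, -ε) ∈ L) →
      ∀ x y, (x, ε) ∈ L → (y, ε) ∈ L → x = y := by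
    rintro ε hε ⟨x₀, hx₀⟩ ⟨x₁, hx₁⟩ 
    obtain ⟨v, hv, hmax⟩ := exists_extreme_max (L := L) ⟨_, h0⟩ (g₀ := (0, ε)) (by simp; omega)
    obtain ⟨g, hg, hk⟩ := hS.killed_of_six (by omega) hv hI
    have hv2 : 0 < ε * v.2 := by
      have := hmax _ hx₀
      simp [dot] at this
      have : ε * ε = 1 := by rcases hε with rfl | rfl <;> rfl
      omega
    have k0 := hk _ h0 (by rintro rfl; simp at hv2)
    have k2 := hk _ hI2 (by rintro rfl; simp at hv2)
    have k1 := hk _ hx₁ (by rintro rfl; simp at hv2; nlinarith)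
    simp [dot] at k0 k1 k2
    have hg1 : g.1 = 0 := by omega
    have hg2 : g.2 ≠ 0 := fun h => hg (Prod.ext hg1 h)
    have hall : ∀ x, (x, ε) ∈ L → (x, ε) = v := by
      intro x hx
      by_contra hne
      have k := hk _ hx hne
      simp [dot, hg1] at k k1
      rcases hε with rfl | rfl <;> omega
    intro x y hx hy
    exact congrArg Prod.fst ((hall x hx).trans (hall y hy).symm)
  have e1 := top 1 (Or.inl rfl) ⟨_, ha₁⟩ ⟨_, hb₁⟩ _ _ ha₁ ha₂
  have e2 := top (-1) (Or.inr rfl) ⟨_, hb₁⟩ ⟨_, ha₁⟩ _ _ hb₁ hb₂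
  omega

/-- The interior points of a stuck set are not collinear. -/
theorem Stuck.not_coll (hS : Stuck L) : ¬ Coll (intr L) := by
  intro hc
  have h3 := hS.three_le
  obtain ⟨p, hp, q, hq, hpq⟩ := Finset.one_lt_card.1 (by omega : 1 < (intr L).card)
  obtain ⟨k, e, f, hk, hqp, hef⟩ := exists_coprime_factor (sub_ne_zero.2 hpq.symm)
  -- The origin is the first interior point along `e`, so the others get nonnegative abscissa.
  obtain ⟨o, ho, hmin⟩ := (intr L).exists_min_image (fun s => det s f) ⟨p, hp⟩
  have hline : ∀ r ∈ intr L, det e (r - o) = 0 := by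
    have hp' : ∀ r ∈ intr L, det e (r - p) = 0 := by
      intro r hr
      have h := hc p hp q hq r hr
      rw [hqp] at h
      have e : det (k • e) (r - p) = k * det e (r - p) := by simp [det]; ring
      rw [e] at h
      rcases mul_eq_zero.1 h with h | h <;> omega
    intro r hr
    have h1 := hp' r hr
    have h2 := hp' o ho
    simp only [det, Prod.fst_sub, Prod.snd_sub] at *
    linear_combination h1 - h2
  have hφ := unimod_frame o e f hef
  have hS' := hS.map hφ
  set M := L.map (frame o e f hef).toEmbedding with hM
  have hM0 : ∀ z ∈ intr M, z.2 = 0 ∧ 0 ≤ z.1 := by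
    intro z hz
    rw [intr_map hφ] at hz
    obtain ⟨r, hr, rfl⟩ := Finset.mem_map.1 hz
    refine ⟨hline r hr, ?_⟩
    have := hmin r hr
    simp [frame, det] at *
    linarith
  have h0 : ((0, 0) : ℤ × ℤ) ∈ intr M := by
    rw [intr_map hφ, mem_map_frame]
    simpa using ho
  obtain ⟨w, hw, hmax⟩ := (intr M).exists_max_image Prod.fst ⟨_, h0⟩
  have hw0 := hM0 w hw
  have hseg : IntrSegment M w.1 := by
    intro z
    refine ⟨fun hz => ⟨(hM0 z hz).1, (hM0 z hz).2, hmax z hz⟩, fun ⟨hz2, hz0, hz1⟩ => ?_⟩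
    rcases hz1.lt_or_eq with h | h
    · exact mem_intr_of_intPt hS'.conv (intPt_of_comb (α := w.1 - z.1) (β := z.1) (γ := 0)
        (k := w.1) (mem_intr.1 h0).2 (intr_subset _ hw) (intr_subset _ hw) (by omega) hz0 le_rfl
        (by ring) (by simp; ring) (by simp [hz2, hw0.1]))
    · rwa [show z = w from Prod.ext h (hz2.trans hw0.1.symm)]
  refine hS'.not_intrSegment ?_ hseg
  have hsub : intr M ⊆ (Finset.Icc 0 w.1).map
      ⟨fun x => (x, 0), fun x y h => congrArg Prod.fst h⟩ := by
    intro z hz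
    have h := (hseg z).1 hz
    rw [Finset.mem_map]
    exact ⟨z.1, by rw [Finset.mem_Icc]; exact h.2, Prod.ext rfl h.1.symm⟩
  have := Finset.card_le_card hsub
  rw [Finset.card_map, Int.card_Icc] at this
  have := hS'.three_le
  omega

/-! ### Numerical consequences for stuck sets -/

/-- No vertex of a stuck set kills all interior points. -/
theorem Stuck.not_killed_all (hS : Stuck L) : ∃ z ∈ intr L, ¬ Killed L v z := by
  by_contra! h
  have h1 := bdry_add_card L
  have h2 := hS.three_le
  have h3 := hS.five_le
  exact hS.not_coll (coll_of_killed_all hS.conv (by omega) h)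

theorem Stuck.bdry_eq (hS : Stuck L) : bdry L = 5 := by
  by_contra h
  have h3 := hS.five_le
  obtain ⟨z, hz⟩ := Finset.card_pos.1 (by have := hS.three_le; omega : 0 < (intr L).card)
  obtain ⟨v, hv, -⟩ := exists_extreme_max ⟨z, intr_subset _ hz⟩ (g₀ := (1, 0)) (by simp)
  obtain ⟨w, hw, hk⟩ := hS.not_killed_all (v := v)
  exact hk (hS.killed_of_six (by omega) hv hw)

theorem Stuck.not_killed_of_four (hS : Stuck L) (h4 : 4 ≤ (intr L).card) (hz : z ∈ intr L) :
    ¬ Killed L v z := by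
  intro hk
  obtain ⟨w, hw, hk'⟩ := hS.not_killed_all (v := v)
  exact hk' (hS.killed_of_four h4 hz hk hw)

/-! ### Three interior points -/

/-- The interior points of `L` are the vertices of the standard triangle. -/
def IntrTriangle (L : Finset (ℤ × ℤ)) : Prop :=
  ∀ z, z ∈ intr L ↔ z = (0, 0) ∨ z = (1, 0) ∨ z = (0, 1)

theorem det_cycle : det (-1, 1) (-1, 0) = 1 := by simp [det]

/-- The image of `L` under the affine map that permutes the vertices of the standard triangle
cyclically. -/
def cycle (L : Finset (ℤ × ℤ)) : Finset (ℤ × ℤ) :=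
  L.map (frame (1, 0) (-1, 1) (-1, 0) det_cycle).toEmbedding

theorem mem_cycle {x y : ℤ} : (x, y) ∈ cycle L ↔ (1 - x - y, x) ∈ L := by
  rw [cycle, mem_map_frame]
  simp [sub_eq_add_neg]

theorem Stuck.cycle (h : Stuck L) : Stuck (cycle L) := h.map (unimod_frame _ _ _ _)

theorem IntrTriangle.cycle (h : IntrTriangle L) : IntrTriangle (cycle L) := by
  rintro ⟨x, y⟩
  rw [LatticePolygon.cycle, intr_map (unimod_frame _ _ _ _), ← LatticePolygon.cycle, mem_cycle, h]
  simp only [Prod.mk.injEq]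
  omega

/-- The mirror image of `L` in the diagonal. -/
def mirror (L : Finset (ℤ × ℤ)) : Finset (ℤ × ℤ) := L.map (Equiv.prodComm ℤ ℤ).toEmbedding

theorem mem_mirror {x y : ℤ} : (x, y) ∈ mirror L ↔ (y, x) ∈ L := by
  rw [mirror, Finset.mem_map_equiv]; rfl

theorem Stuck.mirror (h : Stuck L) : Stuck (mirror L) := h.map unimod_swap

theorem intr_mirror : intr (mirror L) = mirror (intr L) := intr_map unimod_swap

theorem IntrTriangle.mirror (h : IntrTriangle L) : IntrTriangle (mirror L) := by
  rintro ⟨x, y⟩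
  rw [intr_mirror, mem_mirror, h]
  simp only [Prod.mk.injEq]
  omega

namespace IntrTriangle

theorem neg_one_le_snd (h : IntrTriangle L) (hL : LatConv L) {s : ℤ × ℤ} (hs : s ∈ L) :
    -1 ≤ s.2 := by
  by_contra! hlt
  obtain ⟨z, m, hm, hmd, hz, h1, h2⟩ := exists_height_neg_one (p := (1, 0)) (p' := (0, 1)) (s := s)
    (d := -s.2) (by simp [det]) (by simp [det]) (by omega)
  obtain ⟨h0L, h0i⟩ := mem_intr.1 ((h (0, 0)).2 (by simp))
  obtain ⟨h1L, h1i⟩ := mem_intr.1 ((h (1, 0)).2 (by simp))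
  have hzi : IntPt L z := by
    by_cases hc : m = 0
    · exact intPt_of_comb (α := -s.2 - 1 - m) (β := m) (γ := 1) (k := -s.2) h0i h1L hs (by omega) hm
        zero_le_one (by ring) (by rw [h1]; simp) (by rw [h2]; simp)
    · exact intPt_of_comb (α := m) (β := -s.2 - 1 - m) (γ := 1) (k := -s.2) h1i h0L hs (by omega)
        (by omega) zero_le_one (by ring) (by rw [h1]; simp) (by rw [h2]; simp)
  simp [det] at hz
  rcases (h z).1 (mem_intr_of_intPt hL hzi) with rfl | rfl | rfl <;> simp at hz

/-- The symmetries of the standard triangle carry the bound for one side to the other two. -/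
theorem bounds (h : IntrTriangle L) (hL : LatConv L) {s : ℤ × ℤ} (hs : s ∈ L) :
    -1 ≤ s.1 ∧ -1 ≤ s.2 ∧ s.1 + s.2 ≤ 2 := by
  have hu := unimod_frame (1, 0) (-1, 1) (-1, 0) det_cycle
  have h1 := h.neg_one_le_snd hL hs
  have h2 := h.cycle.neg_one_le_snd (hL.map hu) (s := (s.2, 1 - s.1 - s.2))
    (by rw [mem_cycle]; simpa using hs)
  have h3 := h.mirror.neg_one_le_snd (hL.map unimod_swap) (s := (s.2, s.1))
    (by rw [mem_mirror]; exact hs)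
  simp only at h2 h3
  omega

theorem corner_nonempty (h : IntrTriangle L) (hL : LatConv L) :
    (-1, -1) ∈ L ∨ (-1, 0) ∈ L ∨ (0, -1) ∈ L := by
  obtain ⟨⟨x, y⟩, hs, hlt⟩ := (mem_intr.1 ((h (0, 0)).2 (by simp))).2 (-1, -1) (by simp)
  have := h.bounds hL hs
  simp [dot] at hlt this
  rcases (by omega : (x = -1 ∧ y = -1) ∨ (x = -1 ∧ y = 0) ∨ (x = 0 ∧ y = -1)) with
    ⟨rfl, rfl⟩ | ⟨rfl, rfl⟩ | ⟨rfl, rfl⟩ <;> simp [hs]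

/-- Without these neighbours, `L` minus the apex lies in the first quadrant, so the apex would kill
all three interior points. -/
theorem corner_apex (h : IntrTriangle L) (hS : Stuck L) (hv : (-1, -1) ∈ L) :
    (-1, 0) ∈ L ∨ (0, -1) ∈ L := by
  by_contra! hn
  have hL := hS.conv
  have hy : ∀ s ∈ L, s ≠ (-1, -1) → 0 ≤ s.2 := by
    rintro ⟨x, y⟩ hs hne
    have hb := h.bounds hL hs
    simp only [ne_eq, Prod.mk.injEq] at *
    by_contra! hlt
    obtain rfl : y = -1 := by omega
    exact hn.2 (hL.mem_of_comb (α := x) (β := 1) (γ := 0) (k := x + 1) hv hs hs (by omega)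
      zero_le_one le_rfl (by omega) (by ring) (by ring) (by ring))
  have hx : ∀ s ∈ L, s ≠ (-1, -1) → 0 ≤ s.1 := by
    rintro ⟨x, y⟩ hs hne
    have hb := h.bounds hL hs
    simp only [ne_eq, Prod.mk.injEq] at *
    by_contra! hlt
    obtain rfl : x = -1 := by omega
    exact hn.1 (hL.mem_of_comb (α := y) (β := 1) (γ := 0) (k := y + 1) hv hs hs (by omega)
      zero_le_one le_rfl (by omega) (by ring) (by ring) (by ring))
  obtain ⟨z, hz, hk⟩ := hS.not_killed_all (v := (-1, -1))
  rcases (h z).1 hz with rfl | rfl | rfl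
  · refine hk ⟨(-1, -1), by simp, fun s hs hne => ?_⟩
    have := hx s hs hne
    have := hy s hs hne
    simp [dot]; omega
  · refine hk ⟨(0, -1), by simp, fun s hs hne => ?_⟩
    have := hy s hs hne
    simpa [dot]
  · refine hk ⟨(-1, 0), by simp, fun s hs hne => ?_⟩
    have := hx s hs hne
    simpa [dot]

/-- Here (0,-1) kills (0,0), hence a second interior point. This cannot be (0,1), which is shielded
by (0,0), and it cannot be (1,0) if some (x,-1) with x ≥ 1 is present. -/
theorem corner_below (h : IntrTriangle L) (hS : Stuck L) (h1 : (-1, -1) ∉ L) (h2 : (-1, 0) ∉ L)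
    {x : ℤ} (hx : 1 ≤ x) : (x, -1) ∉ L := by
  intro hxL
  have hL := hS.conv
  obtain ⟨h0L, h0i⟩ := mem_intr.1 ((h (0, 0)).2 (by simp))
  have hk : Killed L (0, -1) (0, 0) := by
    refine ⟨(-1, -1), by simp, fun s hs hne => ?_⟩
    have hb := h.bounds hL hs
    obtain ⟨x, y⟩ := s
    simp only [dot, ne_eq, Prod.mk.injEq] at *
    by_contra! hlt
    rcases (by omega : (x = -1 ∧ y = -1) ∨ (x = -1 ∧ y = 0)) with ⟨rfl, rfl⟩ | ⟨rfl, rfl⟩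
    · exact h1 hs
    · exact h2 hs
  obtain ⟨z, hz, hne, hzk⟩ := hS.exists_other ((h (0, 0)).2 (by simp)) hk
  rcases (h z).1 hz with rfl | rfl | rfl
  · exact hne rfl
  · obtain ⟨g, hg, hgk⟩ := hzk
    have k1 := (dot_lt_of_killing (mem_intr.1 hz).2 hg hgk).2
    have k2 := hgk _ h0L (by simp)
    have k3 := hgk _ hxL (by simp; omega)
    simp [dot] at k1 k2 k3
    nlinarith
  · exact not_killed_of_between (α := 1) (β := 1) (mem_intr.1 hz).2 h0L (by simp) zero_lt_one
      zero_le_one (by simp) (by simp) hzk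

theorem corner_left (h : IntrTriangle L) (hS : Stuck L) (h1 : (-1, -1) ∉ L) (h2 : (0, -1) ∉ L)
    {x : ℤ} (hx : 1 ≤ x) : (-1, x) ∉ L := by
  have := h.mirror.corner_below hS.mirror (mem_mirror.not.2 h1) (mem_mirror.not.2 h2) hx
  rwa [mem_mirror] at this

end IntrTriangle

theorem Stuck.not_intrTriangle (hS : Stuck L) : ¬ IntrTriangle L := by
  classical
  intro h
  have hL := hS.conv
  have hS1 := hS.cycle
  have hS2 := hS1.cycle
  have h1 := h.cycle
  have h2 := h1.cycle
  have hcard : (L \ intr L).card = 5 := by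
    rw [Finset.card_sdiff_of_subset (intr_subset L)]
    exact hS.bdry_eq
  -- The twelve boundary lattice points of the large triangle: three at each corner, then the three
  -- edge midpoints.
  have hset : L \ intr L = ({(-1, -1), (-1, 0), (0, -1), (2, -1), (3, -1), (2, 0), (-1, 2), (-1, 3),
      (0, 2), (1, -1), (-1, 1), (1, 1)} : Finset (ℤ × ℤ)).filter (· ∈ L) := by
    ext ⟨x, y⟩
    rw [Finset.mem_sdiff, h, Finset.mem_filter, and_comm (b := (x, y) ∈ L)]
    refine and_congr_right fun hs => ?_
    have hb := h.bounds hL hs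
    simp only [Finset.mem_insert, Finset.mem_singleton, Prod.mk.injEq] at *
    rcases (by omega : x = -1 ∨ x = 0 ∨ x = 1 ∨ x = 2 ∨ x = 3) with rfl | rfl | rfl | rfl | rfl <;>
      norm_num at hb ⊢ <;> omega
  rw [hset, Finset.card_filter] at hcard
  repeat rw [Finset.sum_insert (by decide)] at hcard
  rw [Finset.sum_singleton] at hcard
  have a0 := h.corner_nonempty hL
  have a1 := h1.corner_nonempty hS1.conv
  have a2 := h2.corner_nonempty hS2.conv
  have b0 := h.corner_apex hS
  have b1 := h1.corner_apex hS1
  have b2 := h2.corner_apex hS2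
  have c0 := fun i j => h.corner_below hS i j (x := 1) le_rfl
  have c1 := fun i j => h1.corner_below hS1 i j (x := 1) le_rfl
  have c2 := fun i j => h2.corner_below hS2 i j (x := 1) le_rfl
  have c0' := fun i j => h.corner_below hS i j (x := 2) one_le_two
  have c1' := fun i j => h1.corner_below hS1 i j (x := 2) one_le_two
  have c2' := fun i j => h2.corner_below hS2 i j (x := 2) one_le_two
  have c0'' := fun i j => h.corner_below hS i j (x := 3) (by norm_num)
  have c1'' := fun i j => h1.corner_below hS1 i j (x := 3) (by norm_num)
  have c2'' := fun i j => h2.corner_below hS2 i j (x := 3) (by norm_num)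
  have d0 := fun i j => h.corner_left hS i j (x := 1) le_rfl
  have d1 := fun i j => h1.corner_left hS1 i j (x := 1) le_rfl
  have d2 := fun i j => h2.corner_left hS2 i j (x := 1) le_rfl
  have d0' := fun i j => h.corner_left hS i j (x := 2) one_le_two
  have d1' := fun i j => h1.corner_left hS1 i j (x := 2) one_le_two
  have d2' := fun i j => h2.corner_left hS2 i j (x := 2) one_le_two
  have d0'' := fun i j => h.corner_left hS i j (x := 3) (by norm_num)
  have d1'' := fun i j => h1.corner_left hS1 i j (x := 3) (by norm_num)
  have d2'' := fun i j => h2.corner_left hS2 i j (x := 3) (by norm_num)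
  simp only [mem_cycle] at a1 a2 b1 b2 c1 c2 c1' c2' c1'' c2'' d1 d2 d1' d2' d1'' d2''
  norm_num at a1 a2 b1 b2 c1 c2 c1' c2' c1'' c2'' d1 d2 d1' d2' d1'' d2'' hcard
  clear hset h1 h2 hS1 hS2
  -- With five points, some corner has exactly one, and it is not the apex. `corner_below` or
  -- `corner_left` then empties the rest of its side, so the next corner is also a single point on
  -- its next side; going round leaves only three points.
  by_cases hr : (-1, -1) ∈ L <;> by_cases hr' : (-1, 0) ∈ L <;> by_cases hr'' : (0, -1) ∈ L <;>
    grind (splits := 20)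

/-- A stuck set has at least four interior points. -/
theorem Stuck.four_le (hS : Stuck L) : 4 ≤ (intr L).card := by
  by_contra! hlt
  have h3 : (intr L).card = 3 := by have := hS.three_le; omega
  obtain ⟨p, hp, q, hq, r, hr, hd⟩ : ∃ p ∈ intr L, ∃ q ∈ intr L, ∃ r ∈ intr L,
      0 < det (q - p) (r - p) := by
    have := hS.not_coll
    simp only [Coll] at this
    push Not at this
    obtain ⟨p, hp, q, hq, r, hr, hd⟩ := this
    rcases lt_or_gt_of_ne hd with h | h
    · refine ⟨p, hp, r, hr, q, hq, ?_⟩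
      simp only [det] at *; linarith
    · exact ⟨p, hp, q, hq, r, hr, h⟩
  have hI : ∀ s ∈ intr L, s = p ∨ s = q ∨ s = r := by
    have hpq : p ≠ q := by rintro rfl; simp [det] at hd
    have hpr : p ≠ r := by rintro rfl; simp [det] at hd
    have hqr : q ≠ r := by rintro rfl; simp [det, mul_comm] at hd
    have hsub : ({p, q, r} : Finset (ℤ × ℤ)) ⊆ intr L := by
      intro s hs
      simp only [Finset.mem_insert, Finset.mem_singleton] at hs
      rcases hs with rfl | rfl | rfl <;> assumption
    have := Finset.eq_of_subset_of_card_le hsub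
      (by rw [h3, Finset.card_eq_three.2 ⟨p, q, r, hpq, hpr, hqr, rfl⟩])
    intro s hs
    rw [← this] at hs
    simpa using hs
  obtain ⟨hpL, hpi⟩ := mem_intr.1 hp
  obtain ⟨hqL, hqi⟩ := mem_intr.1 hq
  obtain ⟨hrL, hri⟩ := mem_intr.1 hr
  have hd1 : det (q - p) (r - p) = 1 := by
    refine det_eq_one_of_empty rfl hd fun z m n hm hn hmn h1 h2 => ?_
    set d := det (q - p) (r - p)
    simp only [Prod.fst_sub, Prod.snd_sub] at h1 h2
    have hi : IntPt L (p + z) := by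
      rcases hm.lt_or_eq with h | h
      · exact intPt_of_comb (α := m) (β := n) (γ := d - m - n) (k := d) hqi hrL hpL h hn (by omega)
          (by ring) (by simp; linear_combination h1) (by simp; linear_combination h2)
      rcases hn.lt_or_eq with h' | h'
      · exact intPt_of_comb (α := n) (β := m) (γ := d - m - n) (k := d) hri hqL hpL h' hm (by omega)
          (by ring) (by simp; linear_combination h1) (by simp; linear_combination h2)
      · exact intPt_of_comb (α := d - m - n) (β := m) (γ := n) (k := d) hpi hqL hrL (by omega) hm hn
          (by ring) (by simp; linear_combination h1) (by simp; linear_combination h2)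
    rcases hI _ (mem_intr_of_intPt hS.conv hi) with h | h | h
    · left; simpa using h
    · right; left; rw [← h]; simp
    · right; right; rw [← h]; simp
  have hφ := unimod_frame p (q - p) (r - p) hd1
  refine (hS.map hφ).not_intrTriangle ?_
  rintro ⟨x, y⟩
  rw [intr_map hφ, Finset.mem_map_equiv]
  have key : ∀ s, (frame p (q - p) (r - p) hd1).symm (x, y) = s ↔
      (x, y) = frame p (q - p) (r - p) hd1 s := fun s => Equiv.symm_apply_eq _
  have e0 : frame p (q - p) (r - p) hd1 p = (0, 0) := by simp [frame, det]
  have e1 : frame p (q - p) (r - p) hd1 q = (1, 0) := by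
    ext
    · exact hd1
    · simp [frame, det]; ring
  have e2 : frame p (q - p) (r - p) hd1 r = (0, 1) := by
    ext
    · simp [frame, det]; ring
    · exact hd1
  rw [← e0, ← e1, ← e2, ← key, ← key, ← key]
  refine ⟨hI _, ?_⟩
  rintro (h | h | h) <;> rw [h] <;> assumption

/-! ### Unimodular cones at vertices that kill nothing -/

/-- Let `u`, `w` be the primitive vectors on the extreme rays. If the triangle 0, `u`, `w` held
another lattice point, one closest to 0, measured parallel to the line `uw`, would be interior to
`L` and killed by 0. -/
theorem exists_ear_zero (hL : LatConv L) (hv : Extreme L 0) (hI : (intr L).Nonempty)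
    (hk : ∀ z ∈ intr L, ¬ Killed L 0 z) :
    ∃ u ∈ L, ∃ w ∈ L, det u w = 1 ∧ ∀ s ∈ L, 0 ≤ det u s ∧ 0 ≤ det s w := by
  classical
  obtain ⟨G, hG⟩ : ∃ G : ℤ × ℤ, ∀ s ∈ L, s ≠ 0 → 0 < dot G s := by
    obtain ⟨-, g, hg⟩ := hv
    refine ⟨-g, fun s hs h0 => ?_⟩
    have := hg s hs h0
    simp [dot] at *
    omega
  obtain ⟨z₁, hz₁⟩ := hI
  have hz₁0 : z₁ ≠ 0 := by rintro rfl; exact not_intPt_of_extreme hv (mem_intr.1 hz₁).2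
  have hne : (L.erase 0).Nonempty :=
    ⟨z₁, Finset.mem_erase.2 ⟨hz₁0, intr_subset _ hz₁⟩⟩
  -- The slope relative to the direction `G`, positive on `L \ {0}`; its extremes give the extreme
  -- rays.
  set h : ℤ × ℤ → ℚ := fun s => (dot (-G.2, G.1) s : ℚ) / (dot G s : ℚ) with hh
  have hGG : 0 < G.1 ^ 2 + G.2 ^ 2 := by
    have : G ≠ 0 := by
      rintro rfl
      have := hG z₁ (intr_subset _ hz₁) hz₁0
      simp [dot] at this
    by_contra! hle
    apply this
    ext
    · simp; nlinarith [sq_nonneg G.1, sq_nonneg G.2]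
    · simp; nlinarith [sq_nonneg G.1, sq_nonneg G.2]
  have slope : ∀ a ∈ L.erase 0, ∀ b ∈ L.erase 0, h a ≤ h b → 0 ≤ det a b := by
    intro a ha b hb hab
    rw [Finset.mem_erase] at ha hb
    have h1 := hG a ha.2 ha.1
    have h2 := hG b hb.2 hb.1
    rw [hh] at hab
    simp only at hab
    rw [div_le_div_iff₀ (by exact_mod_cast h1) (by exact_mod_cast h2)] at hab
    have hab' : dot (-G.2, G.1) a * dot G b ≤ dot (-G.2, G.1) b * dot G a := by exact_mod_cast hab
    have e : (G.1 ^ 2 + G.2 ^ 2) * det a b =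
        dot (-G.2, G.1) b * dot G a - dot (-G.2, G.1) a * dot G b := by
      simp only [dot, det]; ring
    by_contra! hlt
    nlinarith
  have det_zero : ∀ s, det s 0 = 0 ∧ det 0 s = 0 := fun s => by simp [det]
  have prim : ∀ u ∈ L.erase 0, ∃ u₀ ∈ L.erase 0, ∃ k : ℤ, ∃ u', 1 ≤ k ∧ u = k • u₀ ∧
      det u₀ u' = 1 := by
    intro u hu
    rw [Finset.mem_erase] at hu
    obtain ⟨k, u₀, u', hk, rfl, hu'⟩ := exists_coprime_factor hu.1
    refine ⟨u₀, Finset.mem_erase.2 ⟨?_, ?_⟩, k, u', hk, rfl, hu'⟩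
    · rintro rfl; simp [det] at hu'
    · exact hL.mem_of_comb (α := 1) (β := k - 1) (γ := 0) (k := k) hu.2 hv.1 hv.1 zero_le_one
        (by omega) le_rfl (by omega) (by ring) (by simp) (by simp)
  obtain ⟨u, hu, u', huu', hus⟩ : ∃ u ∈ L.erase 0, ∃ u', det u u' = 1 ∧ ∀ s ∈ L, 0 ≤ det u s := by
    obtain ⟨u₁, hu₁, hmin⟩ := (L.erase 0).exists_min_image h hne
    obtain ⟨u, hu, k, u', hk, rfl, huu'⟩ := prim u₁ hu₁
    refine ⟨u, hu, u', huu', fun s hs => ?_⟩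
    by_cases hs0 : s = 0
    · rw [hs0, (det_zero u).1]
    · have hs' := Finset.mem_erase.2 ⟨hs0, hs⟩
      have h1 := slope _ hu₁ s hs' (hmin s hs')
      have e : det (k • u) s = k * det u s := by simp [det]; ring
      rw [e] at h1
      exact nonneg_of_mul_nonneg_right h1 (by omega)
  obtain ⟨w, hw, w', hww', hws⟩ : ∃ w ∈ L.erase 0, ∃ w', det w w' = 1 ∧ ∀ s ∈ L, 0 ≤ det s w := by
    obtain ⟨u₁, hu₁, hmax⟩ := (L.erase 0).exists_max_image h hne
    obtain ⟨u, hu, k, u', hk, rfl, huu'⟩ := prim u₁ hu₁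
    refine ⟨u, hu, u', huu', fun s hs => ?_⟩
    by_cases hs0 : s = 0
    · rw [hs0, (det_zero u).2]
    · have hs' := Finset.mem_erase.2 ⟨hs0, hs⟩
      have h1 := slope s hs' _ hu₁ (hmax s hs')
      have e : det s (k • u) = k * det s u := by simp [det]; ring
      rw [e] at h1
      exact nonneg_of_mul_nonneg_right h1 (by omega)
  rw [Finset.mem_erase] at hu hw
  refine ⟨u, hu.2, w, hw.2, ?_, fun s hs => ⟨hus s hs, hws s hs⟩⟩
  have hGu := hG u hu.2 hu.1
  have hGw := hG w hw.2 hw.1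
  have plucker : ∀ s, dot G s * det u w = dot G u * det s w + dot G w * det u s := by
    intro s; unfold dot det; ring
  have cramer : ∀ g s, det u w * dot g s = det s w * dot g u + det u s * dot g w := by
    intro g s; unfold dot det; ring
  have hd : 0 < det u w := by
    have h1 : 0 < det u z₁ := by
      obtain ⟨s, hs, hlt⟩ := (mem_intr.1 hz₁).2 (u.2, -u.1) (by
        intro h; apply hu.1; simp at h; exact Prod.ext h.2 h.1)
      have := hus s hs
      simp only [det, dot] at *
      linarith
    have h2 := hws z₁ (intr_subset _ hz₁)
    have h3 := plucker z₁
    have h4 := hG z₁ (intr_subset _ hz₁) hz₁0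
    by_contra! hle
    nlinarith [mul_pos hGw h1, mul_nonneg hGu.le h2]
  refine det_eq_one_of_empty rfl hd fun z m n hm hn hmn e1 e2 => ?_
  by_contra! hz
  obtain ⟨hz0, hzu, hzw⟩ := hz
  set d := det u w with hd_def
  have hzL : z ∈ L := hL.mem_of_comb (α := m) (β := n) (γ := d - m - n) (k := d) hu.2 hw.2 hv.1 hm
    hn (by omega) hd (by ring) (by rw [e1]; simp) (by rw [e2]; simp)
  have hn' : det u z = n := by
    have : d * det u z = d * n := by
      simp only [det] at *; linear_combination u.1 * e2 - u.2 * e1 - n * hd_def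
    exact mul_left_cancel₀ hd.ne' this
  have hm' : det z w = m := by
    have : d * det z w = d * m := by
      simp only [det] at *; linear_combination w.2 * e1 - w.1 * e2 - m * hd_def
    exact mul_left_cancel₀ hd.ne' this
  have ray : ∀ a a' s : ℤ × ℤ, det a a' = 1 → det a s = 0 → s = det s a' • a := by
    intro a a' s h1 h2
    unfold det at *
    ext
    · simp; linear_combination (-s.1) * h1 + a'.1 * h2
    · simp; linear_combination (-s.2) * h1 + a'.2 * h2
  have rayu : ∀ s ∈ L, s ≠ 0 → det u s = 0 → d ≤ det s w ∧ (det s w ≤ d → s = u) := by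
    intro s hs hs0 h
    have e := ray u u' s huu' h
    have hG' := hG s hs hs0
    have e1 : dot G s = det s u' * dot G u := by
      conv_lhs => rw [e]
      simp [dot]; ring
    have e2 : det s w = det s u' * d := by
      conv_lhs => rw [e]
      rw [hd_def]; simp [det]; ring
    have hk : 1 ≤ det s u' := by by_contra! hlt; nlinarith
    refine ⟨by nlinarith, fun hle => ?_⟩
    have : det s u' = 1 := by nlinarith
    rw [e, this, one_smul]
  have rayw : ∀ s ∈ L, s ≠ 0 → det s w = 0 → d ≤ det u s ∧ (det u s ≤ d → s = w) := by
    intro s hs hs0 h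
    have e := ray w w' s hww' (by unfold det at *; linarith)
    have hG' := hG s hs hs0
    have e1 : dot G s = det s w' * dot G w := by
      conv_lhs => rw [e]
      simp [dot]; ring
    have e2 : det u s = det s w' * d := by
      conv_lhs => rw [e]
      rw [hd_def]; simp [det]; ring
    have hk : 1 ≤ det s w' := by by_contra! hlt; nlinarith
    refine ⟨by nlinarith, fun hle => ?_⟩
    have : det s w' = 1 := by nlinarith
    rw [e, this, one_smul]
  have hzC : z ∈ L.filter fun s => 0 < det u s ∧ 0 < det s w := by
    rw [Finset.mem_filter]
    refine ⟨hzL, (hus z hzL).lt_of_ne fun h => hzu ?_, (hws z hzL).lt_of_ne fun h => hzw ?_⟩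
    · exact (rayu z hzL hz0 h.symm).2 (by omega)
    · exact (rayw z hzL hz0 h.symm).2 (by omega)
  -- The functional det u s + det s w vanishes at 0 and equals `d` on the line `uw`.
  obtain ⟨z₀, hz₀, hmin⟩ := (L.filter fun s => 0 < det u s ∧ 0 < det s w).exists_min_image
    (fun s => det u s + det s w) ⟨z, hzC⟩
  have hzz := hmin z hzC
  rw [Finset.mem_filter] at hz₀
  obtain ⟨hz₀L, hp1, hp2⟩ := hz₀
  have hall : ∀ s ∈ L, s ≠ 0 → det u z₀ + det z₀ w ≤ det u s + det s w := by
    intro s hs hs0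
    have h1 := hus s hs
    have h2 := hws s hs
    by_cases c1 : det u s = 0
    · have := (rayu s hs hs0 c1).1
      omega
    by_cases c2 : det s w = 0
    · have := (rayw s hs hs0 c2).1
      omega
    exact hmin s (by rw [Finset.mem_filter]; exact ⟨hs, by omega, by omega⟩)
  have eγ : ∀ s, dot (w.2 - u.2, u.1 - w.1) s = det u s + det s w := by
    intro s; simp only [dot, det]; ring
  have γ0 : ((w.2 - u.2, u.1 - w.1) : ℤ × ℤ) ≠ 0 := by
    intro h
    have := eγ z₀
    rw [h] at this
    simp [dot] at this
    omega
  by_cases hzi : IntPt L z₀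
  · refine hk z₀ (mem_intr_of_intPt hL hzi) ⟨-(w.2 - u.2, u.1 - w.1), neg_ne_zero.2 γ0, ?_⟩
    intro s hs hs0
    have eneg : ∀ s, dot (-(w.2 - u.2, u.1 - w.1)) s = -(det u s + det s w) := by
      intro s; rw [← eγ]; simp [dot]; ring
    have := hall s hs hs0
    rw [eneg, eneg]
    omega
  · simp only [IntPt] at hzi
    push Not at hzi
    obtain ⟨g, hg, hgs⟩ := hzi
    have g0 := hgs 0 hv.1
    have gu := hgs u hu.2
    have gw := hgs w hw.2
    have gc := cramer g z₀
    simp only [show dot g 0 = 0 by simp [dot]] at g0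
    rcases g0.lt_or_eq with g0 | g0
    -- A supporting functional that is positive at `z₀` must be constant along `uw`, with `z₀` on
    -- that line. But the interior point `z₁` is at level at least that of `z₀`, so `L` reaches
    -- strictly beyond the line.
    · have hle : det u z₀ + det z₀ w ≤ d := by omega
      have k1 := mul_nonneg hp2.le (sub_nonneg.2 gu)
      have k2 := mul_nonneg hp1.le (sub_nonneg.2 gw)
      have k3 := mul_nonneg (sub_nonneg.2 hle) g0.le
      have j1 : det z₀ w * (dot g z₀ - dot g u) = 0 := by linarith
      have j2 : det u z₀ * (dot g z₀ - dot g w) = 0 := by linarith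
      have j3 : (d - (det u z₀ + det z₀ w)) * dot g z₀ = 0 := by linarith
      have hsum : d - (det u z₀ + det z₀ w) = 0 := (mul_eq_zero.1 j3).resolve_right g0.ne'
      have egu : dot g z₀ - dot g u = 0 := (mul_eq_zero.1 j1).resolve_left hp2.ne'
      have egw : dot g z₀ - dot g w = 0 := (mul_eq_zero.1 j2).resolve_left hp1.ne'
      clear k1 k2 k3 j1 j2 j3
      obtain ⟨s, hs, hlt⟩ := (mem_intr.1 hz₁).2 _ γ0
      rw [eγ, eγ] at hlt
      have h1 := hall z₁ (intr_subset _ hz₁) hz₁0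
      have h2 := hgs s hs
      have h3 := cramer g s
      rw [← sub_eq_zero.1 egu, ← sub_eq_zero.1 egw, ← add_mul, add_comm (det s w)] at h3
      have h4 : d * dot g z₀ < (det u s + det s w) * dot g z₀ :=
        mul_lt_mul_of_pos_right (by omega) g0
      have h5 := mul_le_mul_of_nonneg_left h2 hd.le
      omega
    · rw [← g0] at gu gw gc
      have egu : dot g u = 0 := by nlinarith
      have egw : dot g w = 0 := by nlinarith
      apply hg
      have c1 := cramer g (1, 0)
      have c2 := cramer g (0, 1)
      rw [egu, egw] at c1 c2
      simp [dot, hd.ne'] at c1 c2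
      exact Prod.ext c1 c2

/-- At a vertex whose removal kills no interior point, `L` is contained in a unimodular cone. -/
theorem exists_ear (hL : LatConv L) (hv : Extreme L v) (hI : (intr L).Nonempty)
    (hk : ∀ z ∈ intr L, ¬ Killed L v z) :
    ∃ u w, v + u ∈ L ∧ v + w ∈ L ∧ det u w = 1 ∧
      ∀ s ∈ L, 0 ≤ det u (s - v) ∧ 0 ≤ det (s - v) w := by
  have h1 : det (1, 0) (0, 1) = 1 := by simp [det]
  have hφ := unimod_frame v (1, 0) (0, 1) h1
  have e : ∀ s, frame v (1, 0) (0, 1) h1 s = s - v := fun s => by simp [frame, det]; rfl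
  have em : ∀ s, s ∈ L.map (frame v (1, 0) (0, 1) h1).toEmbedding ↔ v + s ∈ L := by
    rintro ⟨x, y⟩
    rw [mem_map_frame]
    have : v + x • (1, 0) + y • (0, 1) = v + (x, y) := by ext <;> simp
    rw [this]
  obtain ⟨u, hu, w, hw, huw, h⟩ := exists_ear_zero (hL.map hφ)
    (by have := hv.map hφ; rwa [e, sub_self] at this)
    (by rw [intr_map hφ]; simpa using hI) (by
      intro z hz hkz
      rw [intr_map hφ] at hz
      obtain ⟨z, hz', rfl⟩ := Finset.mem_map.1 hz
      refine hk z hz' ((killed_map hφ).1 ?_)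
      rwa [e v, sub_self])
  refine ⟨u, w, (em u).1 hu, (em w).1 hw, huw, fun s hs => h (s - v) ((em _).2 ?_)⟩
  simpa using hs

/-! ### Five boundary points in a quadrant -/

/-- A nonzero functional never attains its maximum over `L` at an interior point. -/
theorem dot_lt_of_bdry {g : ℤ × ℤ} {c : ℤ} (hg : g ≠ 0)
    (h : ∀ s ∈ L, s ∉ intr L → dot g s ≤ c) (hz : z ∈ intr L) : dot g z < c := by
  obtain ⟨s, hs, hmax⟩ := L.exists_max_image (dot g) ⟨z, intr_subset _ hz⟩
  obtain ⟨t, ht, hlt⟩ := (mem_intr.1 hz).2 g hg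
  refine (hlt.trans_le (hmax t ht)).trans_le (h s hs fun hsi => ?_)
  obtain ⟨t, ht, hlt⟩ := (mem_intr.1 hsi).2 g hg
  exact absurd (hmax t ht) (not_le.2 hlt)

section Quadrant

variable (hq : ∀ s ∈ L, 0 ≤ s.1 ∧ 0 ≤ s.2)
include hq

theorem one_le_of_mem_intr (hz : z ∈ intr L) : 1 ≤ z.1 ∧ 1 ≤ z.2 := by
  obtain ⟨s, hs, h⟩ := (mem_intr.1 hz).2 (-1, 0) (by simp)
  obtain ⟨t, ht, h'⟩ := (mem_intr.1 hz).2 (0, -1) (by simp)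
  have := hq s hs
  have := hq t ht
  simp [dot] at h h'
  omega

theorem one_one_mem_intr (hL : LatConv L) (hI : (intr L).Nonempty) (h1 : (1, 0) ∈ L)
    (h2 : (0, 1) ∈ L) : (1, 1) ∈ intr L := by
  obtain ⟨z, hz⟩ := hI
  have := one_le_of_mem_intr hq hz
  exact mem_intr_of_intPt hL (intPt_of_comb (α := 1) (β := z.2 - 1) (γ := z.1 - 1)
    (k := z.1 + z.2 - 1) (mem_intr.1 hz).2 h1 h2 zero_lt_one (by omega) (by omega) (by ring)
    (by simp; ring) (by simp; ring))

/-- If (2,0) is absent, (1,0) is a vertex. One edge of its unimodular cone points to (0,0), so the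
other rises by exactly one row; the interior point (1,1) forces `a ≥ 2`. -/
theorem exists_next (hL : LatConv L) (hI : (intr L).Nonempty)
    (hk : ∀ v, ∀ z ∈ intr L, ¬ Killed L v z) (h0 : (0, 0) ∈ L) (h1 : (1, 0) ∈ L)
    (h2 : (0, 1) ∈ L) :
    ((2, 0) ∈ L ∧ (2, 0) ∉ intr L) ∨ ∃ a : ℤ, 2 ≤ a ∧ (a, 1) ∈ L ∧ (a, 1) ∉ intr L := by
  have h11 := one_one_mem_intr hq hL hI h1 h2
  by_cases h20 : ((2, 0) : ℤ × ℤ) ∈ L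
  · exact Or.inl ⟨h20, fun h => by have := (one_le_of_mem_intr hq h).2; simp at this⟩
  right
  have hext : Extreme L (1, 0) := by
    -- The second coefficient is negative enough that points above the axis lose to (1,0).
    refine ⟨h1, (1, -(1 + ∑ s ∈ L, |s.1|)), fun s hs hne => ?_⟩
    have hs' := hq s hs
    have hle := Finset.single_le_sum (f := fun s : ℤ × ℤ => |s.1|) (fun _ _ => abs_nonneg _) hs
    have habs := le_abs_self s.1
    set N := ∑ s ∈ L, |s.1|
    have hle : |s.1| ≤ N := hle
    simp only [dot]
    rcases hs'.2.lt_or_eq with h | h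
    · nlinarith
    · rw [← h]
      by_contra! hlt
      have hs1 : s.1 ≠ 1 := fun h1 => hne (Prod.ext h1 h.symm)
      refine h20 (hL.mem_of_comb (α := 1) (β := s.1 - 2) (γ := 0) (k := s.1 - 1) hs h1 h1
        zero_le_one (by omega) le_rfl (by omega) (by ring) (by simp; ring) (by simp [← h]))
  obtain ⟨e, f, he, hf, hef, hs⟩ := exists_ear hL hext hI (hk _)
  have hf2 := (hs _ h0).2
  have he2 := (hq _ he).2
  have hf2' := (hq _ hf).2
  have he1 := (hs _ (intr_subset _ h11)).1
  simp [det] at hf2 he2 hf2' he1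
  have hf0 : f.2 = 0 := le_antisymm hf2 hf2'
  simp only [det, hf0] at hef
  have he2' : e.2 = 1 := by
    have h : e.2 * (-f.1) = 1 := by linarith
    exact Int.eq_one_or_neg_one_of_mul_eq_one h |>.resolve_right (by omega)
  have hX : ((1, 0) : ℤ × ℤ) + e = (1 + e.1, 1) := by ext <;> simp [he2']
  rw [hX] at he
  have hs1 : ∀ s ∈ L, s.1 - 1 ≤ e.1 * s.2 := by
    intro s hs'
    have := (hs s hs').1
    simp [det, he2'] at this
    linarith
  refine ⟨1 + e.1, ?_, he, fun hX' => ?_⟩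
  · by_contra! hlt
    obtain ⟨s, hs', hlt'⟩ := (mem_intr.1 h11).2 (1, 0) (by simp)
    have h3 := hs1 s hs'
    simp [dot] at hlt'
    have : e.1 = 0 := by omega
    rw [this] at h3
    omega
  · obtain ⟨s, hs', hlt'⟩ := (mem_intr.1 hX').2 (1, -e.1) (by simp)
    have h3 := hs1 s hs'
    simp [dot] at hlt'
    linarith

end Quadrant

/-- The next boundary points X and Y complete the list of five. If both are on the axes, (1,1) is
not interior; if one is, the interior points lie on a line; if neither is, X = (a,1) kills an
interior point. -/
theorem Stuck.not_quadrant (hS : Stuck L) (hq : ∀ s ∈ L, 0 ≤ s.1 ∧ 0 ≤ s.2) (h0 : (0, 0) ∈ L)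
    (h1 : (1, 0) ∈ L) (h2 : (0, 1) ∈ L) : False := by
  classical
  have hL := hS.conv
  have hI : (intr L).Nonempty := Finset.card_pos.1 (by have := hS.four_le; omega)
  have h11 := one_one_mem_intr hq hL hI h1 h2
  have hk : ∀ v, ∀ z ∈ intr L, ¬ Killed L v z := fun v z hz => hS.not_killed_of_four hS.four_le hz
  have hX := exists_next hq hL hI hk h0 h1 h2
  have hS' := hS.mirror
  have hY := exists_next (L := LatticePolygon.mirror L) (fun s hs => by
      have := hq s.swap (mem_mirror.1 hs); exact ⟨this.2, this.1⟩) hS'.conv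
    (Finset.card_pos.1 (by have := hS'.four_le; omega))
    (fun v z hz => hS'.not_killed_of_four hS'.four_le hz) (mem_mirror.2 h0) (mem_mirror.2 h2)
    (mem_mirror.2 h1)
  simp only [intr_mirror, mem_mirror] at hY
  have hax : ∀ x y : ℤ, x = 0 ∨ y = 0 → (x, y) ∉ intr L := by
    intro x y hxy h
    have := one_le_of_mem_intr hq h
    simp only at this
    omega
  have five : ∀ X Y : ℤ × ℤ, X ∈ L → X ∉ intr L → Y ∈ L → Y ∉ intr L → X ≠ Y →
      X ≠ (0, 0) → X ≠ (1, 0) → X ≠ (0, 1) → Y ≠ (0, 0) → Y ≠ (1, 0) → Y ≠ (0, 1) →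
      ∀ s ∈ L, s ∉ intr L → s = (0, 0) ∨ s = (1, 0) ∨ s = (0, 1) ∨ s = X ∨ s = Y := by
    intro X Y hX hX' hY hY' n1 n2 n3 n4 n5 n6 n7 s hs hsi
    have hsub : ({(0, 0), (1, 0), (0, 1), X, Y} : Finset (ℤ × ℤ)) ⊆ L \ intr L := by
      intro t ht
      simp only [Finset.mem_insert, Finset.mem_singleton] at ht
      rw [Finset.mem_sdiff]
      rcases ht with rfl | rfl | rfl | rfl | rfl
      · exact ⟨h0, hax _ _ (by simp)⟩
      · exact ⟨h1, hax _ _ (by simp)⟩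
      · exact ⟨h2, hax _ _ (by simp)⟩
      · exact ⟨hX, hX'⟩
      · exact ⟨hY, hY'⟩
    have hcard : (L \ intr L).card = 5 := by
      rw [Finset.card_sdiff_of_subset (intr_subset L)]
      exact hS.bdry_eq
    have hc5 : ({(0, 0), (1, 0), (0, 1), X, Y} : Finset (ℤ × ℤ)).card = 5 := by
      rw [Finset.card_insert_of_notMem, Finset.card_insert_of_notMem, Finset.card_insert_of_notMem,
        Finset.card_pair n1]
      · simp [n4.symm, n7.symm]
      · simp [n3.symm, n6.symm]
      · simp [n2.symm, n5.symm]
    have heq := Finset.eq_of_subset_of_card_le hsub (by omega)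
    have hs' := Finset.mem_sdiff.2 ⟨hs, hsi⟩
    rw [← heq] at hs'
    simpa using hs'
  rcases hX with ⟨hX, hX'⟩ | ⟨a, ha, hX, hX'⟩ <;> rcases hY with ⟨hY, hY'⟩ | ⟨b, hb, hY, hY'⟩
  · have hB := five _ _ hX hX' hY hY' (by simp) (by simp) (by simp)
      (by simp) (by simp) (by simp) (by simp)
    have := dot_lt_of_bdry (g := (1, 1)) (c := 2) (by simp) (fun s hs hsi => by
      rcases hB s hs hsi with rfl | rfl | rfl | rfl | rfl <;> simp [dot]) h11
    simp [dot] at this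
  · have hB := five _ _ hX hX' hY hY' (by simp) (by simp) (by simp)
      (by simp) (by simp) (by simp; omega) (by simp)
    have hz : ∀ z ∈ intr L, z.1 = 1 := by
      intro z hz
      have h3 := dot_lt_of_bdry (g := (1, 0)) (c := 2) (by simp) (fun s hs hsi => by
        rcases hB s hs hsi with rfl | rfl | rfl | rfl | rfl <;> simp [dot]) hz
      have h4 := one_le_of_mem_intr hq hz
      simp [dot] at h3
      omega
    exact hS.not_coll fun p hp q hq r hr => by simp [det, hz p hp, hz q hq, hz r hr]
  · have hB := five _ _ hX hX' hY hY' (by simp) (by simp) (by simp)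
      (by simp; omega) (by simp) (by simp) (by simp)
    have hz : ∀ z ∈ intr L, z.2 = 1 := by
      intro z hz
      have h3 := dot_lt_of_bdry (g := (0, 1)) (c := 2) (by simp) (fun s hs hsi => by
        rcases hB s hs hsi with rfl | rfl | rfl | rfl | rfl <;> simp [dot]) hz
      have h4 := one_le_of_mem_intr hq hz
      simp [dot] at h3
      omega
    exact hS.not_coll fun p hp q hq r hr => by simp [det, hz p hp, hz q hq, hz r hr]
  · have hB := five _ _ hX hX' hY hY' (by simp; omega) (by simp) (by simp)
      (by simp; omega) (by simp) (by simp; omega) (by simp)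
    -- An interior point whose abscissa is at least that of every point of `L` other than (a,1) is
    -- killed by (a,1). So `t` is on the boundary, its abscissa is at most 1, and (1,1) is killed.
    obtain ⟨t, ht, hmax⟩ := (L.erase (a, 1)).exists_max_image Prod.fst
      ⟨(0, 0), Finset.mem_erase.2 ⟨by simp, h0⟩⟩
    rw [Finset.mem_erase] at ht
    have kill : ∀ c : ℤ, t.1 ≤ c → ∀ y, (c, y) ∈ intr L → False := by
      intro c hc y hcy
      refine hk (a, 1) _ hcy ⟨(1, 0), by simp, fun s hs hne => ?_⟩
      have := hmax s (Finset.mem_erase.2 ⟨hne, hs⟩)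
      simp [dot]
      omega
    have hti : t ∉ intr L := fun h => kill t.1 le_rfl t.2 h
    refine kill 1 ?_ 1 h11
    rcases hB t ht.2 hti with rfl | rfl | rfl | rfl | rfl
    · simp
    · simp
    · simp
    · exact absurd rfl ht.1
    · simp

/-! ### The descent -/

theorem not_stuck (L : Finset (ℤ × ℤ)) : ¬ Stuck L := by
  intro hS
  have hI : (intr L).Nonempty := Finset.card_pos.1 (by have := hS.four_le; omega)
  obtain ⟨v, hv, -⟩ := exists_extreme_max (hI.mono (intr_subset L)) (g₀ := (1, 0)) (by simp)
  obtain ⟨u, w, hu, hw, huw, hs⟩ := exists_ear hS.conv hv hI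
    (fun z hz => hS.not_killed_of_four hS.four_le hz)
  refine (hS.map (unimod_frame v u w huw)).not_quadrant ?_ ?_ ?_ ?_
  · intro z hz
    obtain ⟨s, hs', rfl⟩ := Finset.mem_map.1 hz
    exact ⟨(hs s hs').2, (hs s hs').1⟩
  · rw [mem_map_frame]; simpa using hv.1
  · rw [mem_map_frame]; simpa using hu
  · rw [mem_map_frame]; simpa using hw

theorem exists_admissible_subset (hL : LatConv L) (hT : ((intr L).card, bdry L) ∈ typesT) :
    ∃ M ⊆ L, LatConv M ∧ ((intr M).card, bdry M) ∈ typesS := by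
  induction h : L.card generalizing L with
  | zero =>
    have := Finset.card_le_card (intr_subset L)
    simp only [typesT, Set.mem_ofPred_eq] at hT
    omega
  | succ n ih =>
    by_cases hi : (intr L).card = 1 ∨ (intr L).card = 2
    · exact ⟨L, subset_rfl, hL, hT, hi⟩
    by_contra! hM
    refine not_stuck L ⟨hL, ?_, ?_, fun v hv hc hTv => ?_⟩
    · simp only [typesT, Set.mem_ofPred_eq] at hT; omega
    · simp only [typesT, Set.mem_ofPred_eq] at hT; omega
    · obtain ⟨M, hMs, hMc, hMT⟩ := ih hc hTv (by rw [Finset.card_erase_of_mem hv]; omega)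
      exact hM M (hMs.trans (Finset.erase_subset _ _)) hMc hMT

/-! ### Integral separation -/

/-- Finitely many strict inequalities define an open set of functionals; it contains a rational one,
whose denominators can be cleared. -/
theorem exists_int_of_neg {g : ℝ × ℝ} (h : ∀ s ∈ L, g.1 * s.1 + g.2 * s.2 < 0) :
    ∃ g' : ℤ × ℤ, ∀ s ∈ L, dot g' s < 0 := by
  have hopen : IsOpen {g : ℝ × ℝ | ∀ s ∈ L, g.1 * s.1 + g.2 * s.2 < 0} := by
    have : {g : ℝ × ℝ | ∀ s ∈ L, g.1 * s.1 + g.2 * s.2 < 0} =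
        ⋂ s ∈ L, {g : ℝ × ℝ | g.1 * s.1 + g.2 * s.2 < 0} := by ext; simp
    rw [this]
    exact isOpen_biInter_finset fun s _ => isOpen_lt (by fun_prop) continuous_const
  have hdense : DenseRange (Prod.map ((↑) : ℚ → ℝ) ((↑) : ℚ → ℝ)) :=
    Rat.denseRange_cast.prodMap Rat.denseRange_cast
  obtain ⟨⟨p, q⟩, hpq⟩ := hdense.exists_mem_open hopen ⟨g, h⟩
  refine ⟨(p.num * q.den, q.num * p.den), fun s hs => ?_⟩
  have h1 : (p : ℝ) * s.1 + q * s.2 < 0 := hpq s hs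
  have h2 : p * s.1 + q * s.2 < 0 := by exact_mod_cast h1
  have hp : (0 : ℚ) < p.den := by exact_mod_cast p.den_pos
  have hq : (0 : ℚ) < q.den := by exact_mod_cast q.den_pos
  have e : ((dot (p.num * q.den, q.num * p.den) s : ℤ) : ℚ) =
      p.den * q.den * (p * s.1 + q * s.2) := by
    have ep : p.den * p = p.num := Rat.den_mul_eq_num p
    have eq : q.den * q = q.num := Rat.den_mul_eq_num q
    simp only [dot]
    push_cast
    rw [← ep, ← eq]
    ring
  have : ((dot (p.num * q.den, q.num * p.den) s : ℤ) : ℚ) < 0 := by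
    rw [e]
    exact mul_neg_of_pos_of_neg (mul_pos hp hq) h2
  exact_mod_cast this

/-- If the functional vanishes at some nonzero `t ∈ L`, it is a real multiple of the integral
functional `det t`. Otherwise it is strictly negative off 0 and density applies. -/
theorem exists_int_of_nonpos {g : ℝ × ℝ} (hg : g ≠ 0)
    (h : ∀ s ∈ L, g.1 * s.1 + g.2 * s.2 ≤ 0) :
    ∃ g' : ℤ × ℤ, g' ≠ 0 ∧ ∀ s ∈ L, dot g' s ≤ 0 := by
  classical
  by_cases hs : ∃ t ∈ L, t ≠ 0 ∧ g.1 * t.1 + g.2 * t.2 = 0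
  · obtain ⟨t, ht, ht0, hgt⟩ := hs
    set k : ℝ := g.2 * t.1 - g.1 * t.2 with hk
    have e : ∀ s : ℤ × ℤ, ((t.1 : ℝ) ^ 2 + t.2 ^ 2) * (g.1 * s.1 + g.2 * s.2) =
        k * (det t s : ℤ) := by
      intro s
      simp only [det, hk]
      push_cast
      linear_combination (t.1 * s.1 + t.2 * s.2 : ℝ) * hgt
    have hle : ∀ s ∈ L, k * (det t s : ℤ) ≤ 0 := by
      intro s hs
      rw [← e]
      exact mul_nonpos_of_nonneg_of_nonpos (by positivity) (h s hs)
    have hk0 : k ≠ 0 := by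
      intro hk0
      apply hg
      have hpos : ((t.1 : ℝ) ^ 2 + t.2 ^ 2) ≠ 0 := by
        intro h0
        have h0' : t.1 ^ 2 + t.2 ^ 2 = 0 := by exact_mod_cast h0
        apply ht0
        ext
        · simp; nlinarith [sq_nonneg t.1, sq_nonneg t.2]
        · simp; nlinarith [sq_nonneg t.1, sq_nonneg t.2]
      have e1 := e (1, 0)
      have e2 := e (0, 1)
      rw [hk0] at e1 e2
      simp only [zero_mul, mul_eq_zero, hpos, false_or] at e1 e2
      ext
      · simpa using e1
      · simpa using e2
    have ed : ∀ s, dot (-t.2, t.1) s = det t s := by intro s; simp only [dot, det]; ring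
    have ht' : ((-t.2, t.1) : ℤ × ℤ) ≠ 0 := by
      intro h; apply ht0; simp at h; exact Prod.ext h.2 h.1
    rcases lt_or_gt_of_ne hk0 with hk0 | hk0
    · refine ⟨-(-t.2, t.1), neg_ne_zero.2 ht', fun s hs => ?_⟩
      have h1 : (0 : ℝ) ≤ (det t s : ℤ) := by
        by_contra! hlt
        have := mul_pos_of_neg_of_neg hk0 hlt
        have := hle s hs
        linarith
      have h2 : 0 ≤ det t s := by exact_mod_cast h1
      have e : dot (-(-t.2, t.1)) s = - dot (-t.2, t.1) s := by simp [dot]; ring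
      rw [e, ed]; omega
    · refine ⟨(-t.2, t.1), ht', fun s hs => ?_⟩
      have h1 : ((det t s : ℤ) : ℝ) ≤ 0 := by
        by_contra! hlt
        have := mul_pos hk0 hlt
        have := hle s hs
        linarith
      rw [ed]
      exact_mod_cast h1
  · push Not at hs
    obtain ⟨g', hg'⟩ := exists_int_of_neg (L := L.erase 0) (g := g) fun s hs' => by
      rw [Finset.mem_erase] at hs'
      exact (h s hs'.2).lt_of_ne (hs s hs'.2 hs'.1)
    by_cases hne : (L.erase 0).Nonempty
    · obtain ⟨t, ht⟩ := hne
      refine ⟨g', ?_, fun s hs => ?_⟩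
      · rintro rfl
        simpa [dot] using hg' t ht
      · by_cases hs0 : s = 0
        · simp [hs0, dot]
        · exact (hg' s (Finset.mem_erase.2 ⟨hs0, hs⟩)).le
    · refine ⟨(1, 0), by simp, fun s hs => ?_⟩
      have hs0 : s = 0 := by
        by_contra hs0
        exact hne ⟨s, Finset.mem_erase.2 ⟨hs0, hs⟩⟩
      simp [hs0, dot]

/-! ### Convex hulls -/

/-- The polygon spanned by `L`. -/
def hull (L : Finset (ℤ × ℤ)) : Set (ℝ × ℝ) := convexHull ℝ (latticePt '' (L : Set (ℤ × ℤ)))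

theorem latticePt_mem_hull (hz : z ∈ L) : latticePt z ∈ hull L :=
  subset_convexHull _ _ ⟨z, hz, rfl⟩

theorem convex_hull (L : Finset (ℤ × ℤ)) : Convex ℝ (hull L) := convex_convexHull _ _

theorem isCompact_hull (L : Finset (ℤ × ℤ)) : IsCompact (hull L) :=
  Set.Finite.isCompact_convexHull (𝕜 := ℝ) (L.finite_toSet.image _)

theorem le_of_mem_hull {g : ℝ × ℝ} {c : ℝ} (h : ∀ s ∈ L, g.1 * s.1 + g.2 * s.2 ≤ c) {x : ℝ × ℝ}
    (hx : x ∈ hull L) : g.1 * x.1 + g.2 * x.2 ≤ c := by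
  have hc : Convex ℝ {x : ℝ × ℝ | g.1 * x.1 + g.2 * x.2 ≤ c} :=
    convex_halfSpace_le (f := fun x : ℝ × ℝ => g.1 * x.1 + g.2 * x.2)
      ⟨fun x y => by simp; ring, fun c x => by simp; ring⟩ c
  refine convexHull_min ?_ hc hx
  rintro _ ⟨s, hs, rfl⟩
  exact h s hs

theorem functional_apply (f : ℝ × ℝ →ₗ[ℝ] ℝ) (x : ℝ × ℝ) :
    f x = f (1, 0) * x.1 + f (0, 1) * x.2 := by
  have : x = x.1 • ((1, 0) : ℝ × ℝ) + x.2 • ((0, 1) : ℝ × ℝ) := by ext <;> simp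
  conv_lhs => rw [this, map_add, map_smul, map_smul]
  simp [mul_comm]

theorem exists_dot_lt_of_functional (f : ℝ × ℝ →ₗ[ℝ] ℝ)
    (h : ∀ s ∈ L, f (latticePt s) < f (latticePt z)) :
    ∃ g : ℤ × ℤ, ∀ s ∈ L, dot g s < dot g z := by
  classical
  obtain ⟨g, hg⟩ := exists_int_of_neg (L := L.image (· - z)) (g := (f (1, 0), f (0, 1))) (by
    intro s hs
    obtain ⟨s, hs', rfl⟩ := Finset.mem_image.1 hs
    have := h s hs'
    rw [functional_apply f (latticePt s), functional_apply f (latticePt z)] at this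
    simp [latticePt] at *
    linarith)
  refine ⟨g, fun s hs => ?_⟩
  have := hg _ (Finset.mem_image_of_mem _ hs)
  simp [dot] at *
  linarith

theorem exists_dot_le_of_functional (f : ℝ × ℝ →ₗ[ℝ] ℝ) (hf : f ≠ 0)
    (h : ∀ s ∈ L, f (latticePt s) ≤ f (latticePt z)) :
    ∃ g : ℤ × ℤ, g ≠ 0 ∧ ∀ s ∈ L, dot g s ≤ dot g z := by
  classical
  obtain ⟨g, hg0, hg⟩ := exists_int_of_nonpos (L := L.image (· - z)) (g := (f (1, 0), f (0, 1)))
    (by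
      intro h0
      simp only [Prod.mk_eq_zero] at h0
      exact hf (LinearMap.ext fun x => by rw [functional_apply, h0.1, h0.2]; simp)) (by
    intro s hs
    obtain ⟨s, hs', rfl⟩ := Finset.mem_image.1 hs
    have := h s hs'
    rw [functional_apply f (latticePt s), functional_apply f (latticePt z)] at this
    simp [latticePt] at *
    linarith)
  refine ⟨g, hg0, fun s hs => ?_⟩
  have := hg _ (Finset.mem_image_of_mem _ hs)
  simp [dot] at *
  linarith

/-- Integral functionals detect the interior because a real supporting functional at a lattice point
can be replaced by an integral one. -/
theorem latticePt_mem_interior_hull : latticePt z ∈ interior (hull L) ↔ IntPt L z := by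
  constructor
  · intro hz g hg
    by_contra! h
    have hle : ∀ x ∈ hull L, (g.1 : ℝ) * x.1 + g.2 * x.2 ≤ dot g z := fun x hx =>
      le_of_mem_hull (g := ((g.1 : ℝ), (g.2 : ℝ))) (fun s hs => by
        have := h s hs
        simp only [dot] at *
        exact_mod_cast this) hx
    have hcont : Filter.Tendsto (fun t : ℝ => latticePt z + t • ((g.1 : ℝ), (g.2 : ℝ)))
        (nhdsWithin 0 (Set.Ioi 0)) (nhds (latticePt z)) := by
      have : Continuous (fun t : ℝ => latticePt z + t • ((g.1 : ℝ), (g.2 : ℝ))) := by fun_prop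
      have := this.tendsto 0
      simp only [zero_smul, add_zero] at this
      exact this.mono_left nhdsWithin_le_nhds
    have hev := (hcont.eventually (mem_interior_iff_mem_nhds.1 hz)).and self_mem_nhdsWithin
    obtain ⟨t, ht, ht0⟩ := hev.exists
    have h1 := hle _ ht
    have ht0 : 0 < t := ht0
    simp only [latticePt, dot, Prod.fst_add, Prod.snd_add, Prod.smul_fst, Prod.smul_snd,
      smul_eq_mul] at h1
    push_cast at h1
    have hpos : (0 : ℝ) < (g.1 : ℝ) ^ 2 + (g.2 : ℝ) ^ 2 := by
      by_contra! hle
      have hle' : g.1 ^ 2 + g.2 ^ 2 ≤ 0 := by exact_mod_cast hle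
      apply hg
      ext
      · simp; nlinarith [sq_nonneg g.1, sq_nonneg g.2]
      · simp; nlinarith [sq_nonneg g.1, sq_nonneg g.2]
    nlinarith [mul_pos ht0 hpos]
  · intro hz
    by_contra hn
    obtain ⟨f, hf, hle⟩ : ∃ f : ℝ × ℝ →ₗ[ℝ] ℝ, f ≠ 0 ∧
        ∀ x ∈ hull L, f x ≤ f (latticePt z) := by
      by_cases hne : (interior (hull L)).Nonempty
      · obtain ⟨f, hf⟩ := geometric_hahn_banach_open_point (convex_hull L).interior
          isOpen_interior hn
        obtain ⟨x₀, hx₀⟩ := hne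
        refine ⟨f.toLinearMap, ?_, fun x hx => ?_⟩
        · intro h0
          have h1 : ∀ x, f x = 0 := fun x => by
            simpa using congrArg (fun l : ℝ × ℝ →ₗ[ℝ] ℝ => l x) h0
          have := hf x₀ hx₀
          rw [h1, h1] at this
          exact lt_irrefl _ this
        · have hcl : x ∈ closure (interior (hull L)) := by
            rw [(convex_hull L).closure_interior_eq_closure_of_nonempty_interior ⟨x₀, hx₀⟩]
            exact subset_closure hx
          exact closure_minimal (fun y hy => (hf y hy).le)
            (isClosed_le f.continuous continuous_const) hcl
      -- A hull with empty interior lies in a proper affine subspace, on which some nonzero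
      -- functional is constant; its sign is chosen to favour `z`.
      · have htop : affineSpan ℝ (hull L) ≠ ⊤ := fun h =>
          hne ((convex_hull L).interior_nonempty_iff_affineSpan_eq_top.2 h)
        obtain ⟨s₀, hs₀, -⟩ := hz (1, 0) (by simp)
        have hmem := subset_affineSpan ℝ (hull L) (latticePt_mem_hull hs₀)
        have hdir : (affineSpan ℝ (hull L)).direction < ⊤ := by
          rw [lt_top_iff_ne_top]
          intro h
          exact htop ((AffineSubspace.direction_eq_top_iff_of_nonempty ⟨_, hmem⟩).1 h)
        obtain ⟨f, hf0, hf⟩ := Submodule.exists_le_ker_of_lt_top _ hdir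
        have hconst : ∀ x ∈ hull L, f x = f (latticePt s₀) := by
          intro x hx
          have := hf (AffineSubspace.vsub_mem_direction (subset_affineSpan ℝ _ hx) hmem)
          rw [LinearMap.mem_ker, vsub_eq_sub, map_sub, sub_eq_zero] at this
          exact this
        rcases le_total (f (latticePt s₀)) (f (latticePt z)) with h | h
        · exact ⟨f, hf0, fun x hx => by rw [hconst x hx]; exact h⟩
        · exact ⟨-f, neg_ne_zero.2 hf0, fun x hx => by simpa [hconst x hx] using h⟩
    obtain ⟨g, hg, hle⟩ := exists_dot_le_of_functional (L := L) (z := z) f hf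
      fun s hs => hle _ (latticePt_mem_hull hs)
    obtain ⟨s, hs, hlt⟩ := hz g hg
    exact absurd (hle s hs) (not_le.2 hlt)

theorem latticePt_mem_hull_iff (hL : LatConv L) : latticePt z ∈ hull L ↔ z ∈ L := by
  refine ⟨fun hz => hL z fun g => ?_, latticePt_mem_hull⟩
  by_contra! h
  have hLne : L.Nonempty := by
    by_contra hne
    rw [Finset.not_nonempty_iff_eq_empty] at hne
    subst hne
    simp [hull] at hz
  obtain ⟨t, ht, hmax⟩ := L.exists_max_image (dot g) hLne
  have h1 := le_of_mem_hull (g := ((g.1 : ℝ), (g.2 : ℝ))) (c := dot g t) (fun s hs => by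
        have := hmax s hs
        simp only [dot] at *
        exact_mod_cast this) hz
  have h2 : dot g z ≤ dot g t := by
    simp only [latticePt, dot] at *
    exact_mod_cast h1
  exact absurd (h t ht) (not_lt.2 h2)

theorem polygonType_hull (hL : LatConv L) : polygonType (hull L) = ((intr L).card, bdry L) := by
  classical
  have h1 : interiorLatticePoints (hull L) = (intr L : Set (ℤ × ℤ)) := by
    ext z
    rw [Finset.mem_coe]
    simp only [interiorLatticePoints, Set.mem_ofPred_eq, latticePt_mem_interior_hull]
    exact ⟨mem_intr_of_intPt hL, fun h => (mem_intr.1 h).2⟩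
  have h2 : boundaryLatticePoints (hull L) = ((L \ intr L : Finset (ℤ × ℤ)) : Set (ℤ × ℤ)) := by
    ext z
    rw [Finset.mem_coe, Finset.mem_sdiff, mem_intr]
    simp only [boundaryLatticePoints, Set.mem_ofPred_eq, (isCompact_hull L).isClosed.frontier_eq,
      Set.mem_sdiff, latticePt_mem_interior_hull, latticePt_mem_hull_iff hL]
    tauto
  rw [polygonType, h1, h2, Set.ncard_coe_finset, Set.ncard_coe_finset,
    Finset.card_sdiff_of_subset (intr_subset L)]
  rfl

theorem isConvexLatticePolygon_hull (hI : (intr L).Nonempty) : IsConvexLatticePolygon (hull L) := by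
  obtain ⟨z, hz⟩ := hI
  exact ⟨⟨_, latticePt_mem_interior_hull.2 (mem_intr.1 hz).2⟩, L, rfl⟩

theorem hull_mono {M : Finset (ℤ × ℤ)} (h : M ⊆ L) : hull M ⊆ hull L :=
  convexHull_mono (Set.image_mono (Finset.coe_subset.2 h))

/-- A lattice polygon is the hull of the set of all its lattice points. -/
theorem exists_latConv_eq_hull (S : Finset (ℤ × ℤ)) : ∃ L, LatConv L ∧ hull S = hull L := by
  have hfin : {z | latticePt z ∈ hull S}.Finite := by
    obtain ⟨R, hR⟩ := (isCompact_hull S).isBounded.subset_closedBall 0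
    refine (Set.finite_Icc ((-⌈R⌉, -⌈R⌉) : ℤ × ℤ) (⌈R⌉, ⌈R⌉)).subset fun z hz => ?_
    have h := hR hz
    rw [mem_closedBall_zero_iff, Prod.norm_def, max_le_iff, Real.norm_eq_abs, Real.norm_eq_abs,
      abs_le, abs_le] at h
    have hc := Int.le_ceil R
    simp only [latticePt] at h
    rw [Set.mem_Icc, Prod.le_def, Prod.le_def]
    have h1 : (-⌈R⌉ : ℝ) ≤ z.1 := by linarith
    have h2 : (z.1 : ℝ) ≤ ⌈R⌉ := by linarith
    have h3 : (-⌈R⌉ : ℝ) ≤ z.2 := by linarith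
    have h4 : (z.2 : ℝ) ≤ ⌈R⌉ := by linarith
    exact ⟨⟨by exact_mod_cast h1, by exact_mod_cast h3⟩, ⟨by exact_mod_cast h2, by exact_mod_cast h4⟩⟩
  have hmem : ∀ z, z ∈ hfin.toFinset ↔ latticePt z ∈ hull S := by simp
  refine ⟨hfin.toFinset, fun z hz => ?_, ?_⟩
  · rw [hmem]
    by_contra hn
    obtain ⟨f, u, h1, h2⟩ := geometric_hahn_banach_closed_point (convex_hull S)
      (isCompact_hull S).isClosed hn
    obtain ⟨g, hg⟩ := exists_dot_lt_of_functional (L := hfin.toFinset) (z := z) f.toLinearMap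
      fun s hs => (h1 _ ((hmem s).1 hs)).trans h2
    obtain ⟨s, hs, hle⟩ := hz g
    exact absurd (hg s hs) (not_lt.2 hle)
  · apply Set.Subset.antisymm
    · exact hull_mono fun s hs => (hmem s).2 (latticePt_mem_hull hs)
    · refine convexHull_min ?_ (convex_hull S)
      rintro _ ⟨s, hs, rfl⟩
      exact (hmem s).1 hs

end LatticePolygon

/-! ### Transfer to polygons -/

theorem mainTheorem8 (P : Set (ℝ × ℝ)) (hP : IsConvexLatticePolygon P)
    (hT : polygonType P ∈ typesT) :
    ∃ P' : Set (ℝ × ℝ), IsConvexLatticePolygon P' ∧ P' ⊆ P ∧ polygonType P' ∈ typesS := by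
  obtain ⟨-, S, rfl⟩ := hP
  obtain ⟨L, hL, hSL⟩ := LatticePolygon.exists_latConv_eq_hull S
  change LatticePolygon.hull S = _ at hSL
  change polygonType (LatticePolygon.hull S) ∈ _ at hT
  rw [hSL, LatticePolygon.polygonType_hull hL] at hT
  obtain ⟨M, hML, hM, hMT⟩ := LatticePolygon.exists_admissible_subset hL hT
  refine ⟨LatticePolygon.hull M, LatticePolygon.isConvexLatticePolygon_hull ?_, ?_, ?_⟩
  · rw [← Finset.card_pos]
    have : (LatticePolygon.intr M).card = 1 ∨ (LatticePolygon.intr M).card = 2 := hMT.2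
    omega
  · change _ ⊆ LatticePolygon.hull S
    rw [hSL]
    exact LatticePolygon.hull_mono hML
  · rwa [LatticePolygon.polygonType_hull hM]
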